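/- Let $m\ge 2$ be an integer and $2\le q<\infty$. Let $L^q_m$ be the closed subspace of the complex-valued functions $f\in L^q(\mathbb R^2)$ with $f\circ R_{2\pi/m}=f$ a.e., where $R_\theta$ is the counterclockwise rotation by $\theta$ around the origin. Let $K_2(x)=\frac{1}{2\pi}\frac{x^\perp}{|x|^2}$, $x^\perp=(-x_2,x_1)$, be the Biot–Savart kernel, and let $\mathcal S^*$ be the space of $\mathbb C^2$-valued tempered distributions on $\mathbb R^2$ (with the topology of pointwise convergence on Schwartz functions). Then there exists a continuous linear operator $T:L^q_m\to\mathcal S^*$ such that: 1. if $\varphi\in L^q_m$ is a Schwartz function, then $T\varphi=K_2*\varphi$ in the sense of distributions; 2. there is a constant $C>0$ (which may depend on $m$ and $q$) such that for every $\varphi\in L^q_m$ there is $v\in W^{1,q}_{loc}(\mathbb R^2;\mathbb C^2)$ with $$R^{-1}\|v\|_{L^q(B_R)}+\|Dv\|_{L^q(B_R)}\le C\|\varphi\|_{L^q(\mathbb R^2)}\quad\text{for all } R>0,$$ where $B_R$ is the ball of radius $R$ centred at the origin, with $\operatorname{div} v=0$ and $T\varphi=v$ in the sense of distributions. Moreover,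 $T$ is unique: every continuous map $T':L^q_m\to\mathcal S^*$ that satisfies 1 is equal to $T$. -/

import Mathlib

open MeasureTheory SchwartzMap
open scoped ENNReal ContDiff

noncomputable section

namespace BiotSavart

/-- The plane with its Euclidean norm. -/
abbrev Plane : Type := EuclideanSpace ℝ (Fin 2)

/-- The values of (complex) velocity fields. -/
abbrev Vel : Type := EuclideanSpace ℂ (Fin 2)

/-- Counterclockwise rotation of the plane by the angle `θ` around the origin. -/
def rot (θ : ℝ) : Plane ≃ₗᵢ[ℝ] Plane where
  toFun x := !₂[Real.cos θ * x 0 - Real.sin θ * x 1, Real.sin θ * x 0 + Real.cos θ * x 1]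
  invFun x := !₂[Real.cos θ * x 0 + Real.sin θ * x 1, -Real.sin θ * x 0 + Real.cos θ * x 1]
  map_add' x y := by
    ext i; fin_cases i <;> simp <;> ring
  map_smul' c x := by
    ext i; fin_cases i <;> simp <;> ring
  left_inv x := by
    ext i
    fin_cases i
    · simp; linear_combination x 0 * Real.sin_sq_add_cos_sq θ
    · simp; linear_combination x 1 * Real.sin_sq_add_cos_sq θ
  right_inv x := by
    ext i
    fin_cases i
    · simp; linear_combination x 0 * Real.sin_sq_add_cos_sq θ
    · simp; linear_combination x 1 * Real.sin_sq_add_cos_sq θ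
  norm_map' x := by
    simp only [EuclideanSpace.norm_eq, Fin.sum_univ_two, Real.norm_eq_abs, sq_abs]
    congr 1
    simp
    linear_combination (x 0 ^ 2 + x 1 ^ 2) * Real.sin_sq_add_cos_sq θ

/-- The space `L^q_m`: the (classes of) complex-valued functions in `L^q` of the plane that are
`m`-fold symmetric, that is, `f ∘ R_{2π/m} = f` almost everywhere. -/
def Lqm (q : ℝ≥0∞) [Fact (1 ≤ q)] (m : ℕ) : Submodule ℂ (Lp ℂ q (volume : Measure Plane)) where
  carrier := {f | ∀ᵐ x, f (rot (2 * Real.pi / m) x) = f x}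
  add_mem' {f g} hf hg := by
    have h := Lp.coeFn_add f g
    have h' := (rot (2 * Real.pi / m)).measurePreserving.quasiMeasurePreserving.ae h
    filter_upwards [hf, hg, h, h'] with x h1 h2 h3 h4
    rw [h4, h3, Pi.add_apply, Pi.add_apply, h1, h2]
  zero_mem' := by
    have h := Lp.coeFn_zero ℂ q (volume : Measure Plane)
    have h' := (rot (2 * Real.pi / m)).measurePreserving.quasiMeasurePreserving.ae h
    filter_upwards [h, h'] with x h3 h4
    rw [h4, h3, Pi.zero_apply, Pi.zero_apply]
  smul_mem' c f hf := by
    have h := Lp.coeFn_smul c f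
    have h' := (rot (2 * Real.pi / m)).measurePreserving.quasiMeasurePreserving.ae h
    filter_upwards [hf, h, h'] with x h1 h3 h4
    rw [h4, h3, Pi.smul_apply, Pi.smul_apply, h1]

/-- The two-dimensional Biot–Savart kernel `K₂(x) = x^⊥ / (2π|x|²)`, `x^⊥ = (-x₂, x₁)`. -/
def K₂ (x : Plane) : Plane :=
  (2 * Real.pi * ‖x‖ ^ 2)⁻¹ • !₂[-x 1, x 0]

/-- The convolution `K₂ * f`, `(K₂ * f)ᵢ(x) = ∫ K₂ᵢ(x - y) f(y) dy`, for a Schwartz function `f`. -/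
def velocity (f : 𝓢(Plane, ℂ)) (x : Plane) : Vel :=
  WithLp.toLp 2 fun i => ∫ y, ((K₂ (x - y) i : ℝ) : ℂ) * f y

/-- The tempered distribution `S` is given by the locally integrable function `v`. -/
def IsGivenBy (S : 𝓢'(Plane, Vel)) (v : Plane → Vel) : Prop :=
  LocallyIntegrable v ∧
    ∀ ψ : 𝓢(Plane, ℂ), Integrable (fun x => ψ x • v x) ∧ S ψ = ∫ x, ψ x • v x

/-- `f ∈ L^q_loc`. -/
def MemLqLoc {F : Type*} [NormedAddCommGroup F] (q : ℝ≥0∞) (f : Plane → F) : Prop :=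
  ∀ K : Set Plane, IsCompact K → MemLp f q (volume.restrict K)

/-- `v ∈ W^{1,q}_loc`, with weak derivative `Dv` (for `1 ≤ q`). -/
structure HasW1qLocDeriv (q : ℝ≥0∞) (v : Plane → Vel) (Dv : Plane → Plane →L[ℝ] Vel) : Prop where
  memLqLoc : MemLqLoc q v
  memLqLoc_deriv : MemLqLoc q Dv
  integral_eq : ∀ ψ : Plane → ℝ, ContDiff ℝ ∞ ψ → HasCompactSupport ψ → ∀ e : Plane,
    ∫ x, fderiv ℝ ψ x e • v x = - ∫ x, ψ x • Dv x e

/-- `div v = 0` in the sense of distributions. -/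
def IsDivFree (v : Plane → Vel) : Prop :=
  ∀ ψ : Plane → ℝ, ContDiff ℝ ∞ ψ → HasCompactSupport ψ →
    ∫ x, ∑ i : Fin 2, fderiv ℝ ψ x (EuclideanSpace.single i 1) • v x i = 0

/-- A map `T : L^q_m → 𝓢'` agrees with `K₂ *` on the Schwartz functions in `L^q_m`. -/
def ExtendsConv {q : ℝ≥0∞} [Fact (1 ≤ q)] {m : ℕ} (T : Lqm q m → 𝓢'(Plane, Vel)) : Prop :=
  ∀ (φ : Lqm q m) (f : 𝓢(Plane, ℂ)), (φ : Lp ℂ q (volume : Measure Plane)) =ᵐ[volume] f →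
    IsGivenBy (T φ) (velocity f)

end BiotSavart

end

open BiotSavart

open MeasureTheory SchwartzMap
open scoped ENNReal ContDiff NNReal

noncomputable section

namespace BiotSavart

open Set Metric

/-! Identify the plane with ℂ. The components of `K₂` are linear combinations of `1/z` and its
conjugate, so `K₂ * f` is assembled from the Cauchy transform of `f` and the conjugate of the Cauchy
transform of the conjugate of `f`. If `u` is the Cauchy transform of `g`, then `∂̄u = πg` and `∂u =
π · beurling g`, so bounding `Du` in `L^q` amounts to bounding the Beurling transform.

For `q = 2` it is an isometry: `|∂u|² - |∂̄u|²` is the Jacobian of `u`, which has integral zero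
(`lintegral_enorm_beurling_sq`). For `q > 2` the bound comes from a good-λ argument for `G =
|beurling g|²` against `H = |g|²`. Near a disc, cutting off `g` splits `beurling g` into a part
controlled in `L²` by the isometry and a part holomorphic near the disc, controlled pointwise by the
mean value property (`exists_local_decomposition`). A stopping radius and a Vitali covering give
`lintegral_superlevel_le`, and integration over all levels gives `exists_lintegral_rpow_le`.

The bound on `v` itself uses the symmetry. If `g` is invariant under rotation by `θ₀ = 2π/m`, then
`u(e^{iθ₀}z) = e^{-iθ₀}u(z)`, and `e^{-iθ₀} ≠ 1` because `m ≥ 2`. Hence `u(z)` is a constant times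
the integral of `Du` along an arc of radius `|z|`, and `u/|z|` is bounded in `L^q` by `Du`
(`lintegral_hardy_le`).

Smooth compactly supported symmetric functions are dense in `L^q_m` (`denseRange_toLqm`). So `f ↦
|x|⁻¹(K₂ * f)` and `f ↦ D(K₂ * f)` extend to bounded operators `A` and `B` into `L^q`, and `Tφ = |x|
Aφ`. The weak identities pass to the limit by density, which also gives uniqueness. Agreement with
`K₂ * f` for Schwartz `f` follows from cutoffs whose velocities converge uniformly. -/

/-- The (unnormalised) Cauchy transform `∫ g(z - w) / w dw` of a function on the plane. -/
def cauchyInt (g : ℂ → ℂ) (z : ℂ) : ℂ := ∫ w, w⁻¹ * g (z - w)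

/-- The Wirtinger derivative `∂`. -/
def wirt (g : ℂ → ℂ) (z : ℂ) : ℂ := (fderiv ℝ g z 1 - Complex.I * fderiv ℝ g z Complex.I) / 2

/-- The Wirtinger derivative `∂̄`. -/
def wirtBar (g : ℂ → ℂ) (z : ℂ) : ℂ := (fderiv ℝ g z 1 + Complex.I * fderiv ℝ g z Complex.I) / 2

/-! ### Regularity of the Cauchy transform. -/

lemma locallyIntegrable_inv : LocallyIntegrable (fun w : ℂ => w⁻¹) := by
  refine locallyIntegrable_of_norm_le_rpow (C := 1) (α := 1) (by simp) (by simp) ?_ ?_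
  · refine .of_forall fun w => ?_
    rw [one_mul, norm_inv, Real.rpow_neg_one]
  · exact measurable_inv.aestronglyMeasurable

lemma cauchyInt_eq_convolution (g : ℂ → ℂ) :
    cauchyInt g = MeasureTheory.convolution (fun w : ℂ => w⁻¹) g (ContinuousLinearMap.mul ℝ ℂ) volume := rfl

lemma integrable_cauchyInt_integrand {g : ℂ → ℂ} (hg : Continuous g) (hc : HasCompactSupport g)
    (z : ℂ) : Integrable fun w : ℂ => w⁻¹ * g (z - w) :=
  hc.convolutionExists_right (ContinuousLinearMap.mul ℝ ℂ) locallyIntegrable_inv hg z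

lemma contDiff_cauchyInt {g : ℂ → ℂ} (hg : ContDiff ℝ ∞ g) (hc : HasCompactSupport g) :
    ContDiff ℝ ∞ (cauchyInt g) := by
  rw [cauchyInt_eq_convolution]
  exact hc.contDiff_convolution_right _ locallyIntegrable_inv hg

lemma fderiv_cauchyInt {g : ℂ → ℂ} (hg : ContDiff ℝ ∞ g) (hc : HasCompactSupport g) (z e : ℂ) :
    fderiv ℝ (cauchyInt g) z e = cauchyInt (fun w => fderiv ℝ g w e) z := by
  have h := (hc.hasFDerivAt_convolution_right (ContinuousLinearMap.mul ℝ ℂ)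
    locallyIntegrable_inv (hg.of_le (by simp)) z).fderiv
  rw [cauchyInt_eq_convolution, h, MeasureTheory.convolution, ContinuousLinearMap.integral_apply]
  · rfl
  · exact (hc.fderiv ℝ).convolutionExists_right _ locallyIntegrable_inv
      (hg.continuous_fderiv (by simp)) z

lemma cauchyInt_eq (g : ℂ → ℂ) (z : ℂ) : cauchyInt g z = ∫ w, (z - w)⁻¹ * g w := by
  rw [cauchyInt, ← integral_sub_left_eq_self _ _ z]
  simp

lemma cauchyInt_add {f g : ℂ → ℂ} (hf : Continuous f) (hfc : HasCompactSupport f)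
    (hg : Continuous g) (hgc : HasCompactSupport g) :
    cauchyInt (f + g) = cauchyInt f + cauchyInt g := by
  ext z
  simp only [cauchyInt, Pi.add_apply, mul_add]
  exact integral_add (integrable_cauchyInt_integrand hf hfc z)
    (integrable_cauchyInt_integrand hg hgc z)

/-! ### The fundamental solution of `∂̄`. -/

section Polar

/-- In polar coordinates the Jacobian `r` cancels the singularity: `2r w⁻¹ ∂̄h = ∂_r h + (i/r) ∂_θ
h`. The radial term (`a` below) integrates to `-h 0` along each ray; the angular term (`b` below,
already divided by `r`) integrates to zero over each circle by periodicity. -/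
lemma integral_inv_mul_wirtBar {h : ℂ → ℂ} (hh : ContDiff ℝ ∞ h) (hc : HasCompactSupport h) :
    ∫ w, w⁻¹ * wirtBar h w = -(Real.pi * h 0) := by
  have hd : Differentiable ℝ h := hh.differentiable (by simp)
  have hcont : Continuous (fderiv ℝ h) := hh.continuous_fderiv (by simp)
  let e : ℝ → ℂ := fun θ => Complex.exp (θ * Complex.I)
  have he : ∀ θ, e θ = Complex.cos θ + Complex.sin θ * Complex.I := fun θ => Complex.exp_mul_I _
  let a : ℝ × ℝ → ℂ := fun p => fderiv ℝ h (p.1 * e p.2) (e p.2)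
  let b : ℝ × ℝ → ℂ := fun p => fderiv ℝ h (p.1 * e p.2) (Complex.I * e p.2)
  have hnorm : ∀ θ, ‖e θ‖ = 1 := fun θ => Complex.norm_exp_ofReal_mul_I θ
  obtain ⟨ρ, hρ0, hρ⟩ : ∃ ρ : ℝ, 0 < ρ ∧ ∀ z : ℂ, ρ < ‖z‖ → fderiv ℝ h z = 0 := by
    obtain ⟨ρ, hρ⟩ := (hc.fderiv ℝ).isCompact.isBounded.subset_closedBall (0 : ℂ)
    refine ⟨max ρ 1, by positivity, fun z hz => ?_⟩
    by_contra hne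
    have := hρ (subset_tsupport _ (Function.mem_support.2 hne))
    rw [mem_closedBall_zero_iff] at this
    exact absurd (lt_of_le_of_lt (le_max_left _ _) hz) (not_lt.2 this)
  have hint : ∀ f : ℝ × ℝ → ℂ, Continuous f → (∀ p, ρ < p.1 → f p = 0) →
      IntegrableOn f (Ioi 0 ×ˢ Ioo (-Real.pi) Real.pi) := by
    intro f hf h0
    refine IntegrableOn.of_forall_sdiff_eq_zero
      (s := Icc 0 ρ ×ˢ Icc (-Real.pi) Real.pi) ?_ (measurableSet_Ioi.prod measurableSet_Ioo) ?_
    · exact hf.continuousOn.integrableOn_compact (isCompact_Icc.prod isCompact_Icc)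
    · rintro p ⟨⟨hp1, hp2⟩, hp⟩
      refine h0 p (not_le.1 fun hle => hp ⟨⟨le_of_lt hp1, hle⟩, ⟨hp2.1.le, hp2.2.le⟩⟩)
  have hzero : ∀ p : ℝ × ℝ, ρ < p.1 → fderiv ℝ h (p.1 * e p.2) = 0 := by
    intro p hp
    refine hρ _ ?_
    rw [norm_mul, hnorm, mul_one, Complex.norm_real]
    exact hp.trans_le (le_abs_self _)
  have ha : IntegrableOn a (Ioi 0 ×ˢ Ioo (-Real.pi) Real.pi) :=
    hint a (by fun_prop) fun p hp => by simp [a, hzero p hp]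
  have hb : IntegrableOn b (Ioi 0 ×ˢ Ioo (-Real.pi) Real.pi) :=
    hint b (by fun_prop) fun p hp => by simp [b, hzero p hp]
  have inta : ∫ p in Ioi (0 : ℝ) ×ˢ Ioo (-Real.pi) Real.pi, a p = -(2 * Real.pi * h 0) := by
    rw [Measure.volume_eq_prod, setIntegral_prod _ (by rwa [← Measure.volume_eq_prod]),
      integral_integral_swap]
    · have : ∀ θ : ℝ, ∫ r in Ioi (0 : ℝ), a (r, θ) = -h 0 := by
        intro θ
        have h1 : ∀ r : ℝ, HasDerivAt (fun r : ℝ => h (r * e θ)) (a (r, θ)) r := by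
          intro r
          have := (hd (r * e θ)).hasFDerivAt.comp_hasDerivAt r
            ((Complex.ofRealCLM.hasDerivAt (x := r)).mul_const (e θ))
          simp only [Complex.ofRealCLM_apply, Complex.ofReal_one, one_mul] at this
          exact this
        have h2 : HasCompactSupport (fun r : ℝ => h (r * e θ)) := by
          refine hc.comp_isClosedEmbedding (g := fun r : ℝ => (r : ℂ) * e θ) ?_
          refine Isometry.isClosedEmbedding (Isometry.of_dist_eq fun x y => ?_)
          rw [dist_eq_norm, ← sub_mul, norm_mul, hnorm, mul_one, ← Complex.ofReal_sub,
            Complex.norm_real, dist_eq_norm]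
        have h3 : ContDiff ℝ 1 (fun r : ℝ => h (r * e θ)) :=
          (hh.of_le (by simp)).comp
            (Complex.ofRealCLM.contDiff.mul contDiff_const)
        have := h2.integral_Ioi_deriv_eq h3 0
        simp only [(h1 _).deriv] at this
        simpa using this
      simp only [this]
      simp [Measure.real, Real.pi_pos.le, ← two_mul]
    · rw [Measure.prod_restrict, ← Measure.volume_eq_prod]; exact ha
  have intb : ∫ p in Ioi (0 : ℝ) ×ˢ Ioo (-Real.pi) Real.pi, b p = 0 := by
    rw [Measure.volume_eq_prod, setIntegral_prod _ (by rwa [← Measure.volume_eq_prod])]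
    refine setIntegral_eq_zero_of_forall_eq_zero fun r hr => ?_
    have hr' : (r : ℂ) ≠ 0 := by simpa using (ne_of_gt hr)
    have h1 : ∀ θ : ℝ, HasDerivAt (fun θ : ℝ => h (r * e θ)) (r * b (r, θ)) θ := by
      intro θ
      have h0 : HasDerivAt e (e θ * Complex.I) θ := by
        simpa using ((Complex.ofRealCLM.hasDerivAt (x := θ)).mul_const Complex.I).cexp
      have := (hd (r * e θ)).hasFDerivAt.comp_hasDerivAt θ (h0.const_mul (r : ℂ))
      rw [show (r : ℂ) * (e θ * Complex.I) = r • (Complex.I * e θ) by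
        rw [Complex.real_smul, mul_comm (e θ)], map_smul, Complex.real_smul] at this
      exact this
    have h2 : ∫ θ in (-Real.pi)..Real.pi, (r : ℂ) * b (r, θ) = 0 := by
      rw [intervalIntegral.integral_eq_sub_of_hasDerivAt (fun θ _ => h1 θ)]
      · simp [e, Complex.exp_neg]
      · refine Continuous.intervalIntegrable ?_ _ _
        fun_prop
    rw [intervalIntegral.integral_const_mul, mul_eq_zero, or_iff_right hr',
      intervalIntegral.integral_of_le (by linarith [Real.pi_pos]), integral_Ioc_eq_integral_Ioo]
      at h2
    exact h2
  rw [← Complex.integral_comp_polarCoord_symm]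
  have key : ∀ p ∈ polarCoord.target, p.1 • ((Complex.polarCoord.symm p)⁻¹ *
      wirtBar h (Complex.polarCoord.symm p)) = (2 : ℂ)⁻¹ * (a p + Complex.I * b p) := by
    rintro ⟨r, θ⟩ ⟨hr, -⟩
    have hr' : (r : ℂ) ≠ 0 := by simpa using (ne_of_gt hr)
    have hp : Complex.polarCoord.symm (r, θ) = r * e θ := by
      rw [he]; simp
    simp only [hp, wirtBar, a, b]
    set L := fderiv ℝ h (r * e θ)
    have hL : ∀ z : ℂ, L z = z.re * L 1 + z.im * L Complex.I := by
      intro z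
      conv_lhs => rw [show z = z.re • (1 : ℂ) + z.im • Complex.I by
        simp [Complex.re_add_im]]
      rw [map_add, map_smul, map_smul, Complex.real_smul, Complex.real_smul]
    have hI : e θ = Real.cos θ + Real.sin θ * Complex.I := by rw [he]; simp
    have h1 : L (e θ) = Real.cos θ * L 1 + Real.sin θ * L Complex.I := by
      rw [hL, hI]; simp [Complex.cos_ofReal_re, Complex.sin_ofReal_re]
    have h2 : L (Complex.I * e θ) = -Real.sin θ * L 1 + Real.cos θ * L Complex.I := by
      rw [hL, hI]; simp [Complex.cos_ofReal_re, Complex.sin_ofReal_re]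
    have hinv : (e θ)⁻¹ = Real.cos θ - Real.sin θ * Complex.I := by
      simp only [e]
      rw [← Complex.exp_neg, ← neg_mul, Complex.exp_mul_I]
      simp [sub_eq_add_neg]
    rw [h1, h2, Complex.real_smul, mul_inv, hinv]
    field_simp
    linear_combination (-(Real.sin θ : ℂ) * L Complex.I) * Complex.I_sq
  rw [setIntegral_congr_fun polarCoord.open_target.measurableSet key]
  have ht : polarCoord.target = Ioi (0 : ℝ) ×ˢ Ioo (-Real.pi) Real.pi := rfl
  rw [ht, integral_const_mul, integral_add ha (hb.const_mul _), inta, integral_const_mul, intb]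
  ring

end Polar

lemma contDiff_fderiv_apply {g : ℂ → ℂ} (hg : ContDiff ℝ ∞ g) (e : ℂ) :
    ContDiff ℝ ∞ fun w => fderiv ℝ g w e :=
  (hg.fderiv_right (m := ∞) (by simp)).clm_apply contDiff_const

lemma contDiff_wirt {g : ℂ → ℂ} (hg : ContDiff ℝ ∞ g) : ContDiff ℝ ∞ (wirt g) :=
  ((contDiff_fderiv_apply hg 1).sub
    (contDiff_const.mul (contDiff_fderiv_apply hg Complex.I))).div_const 2

/-- `1/(πz)` is the fundamental solution of `∂̄`: the derivative is moved onto `g`, and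
`integral_inv_mul_wirtBar` is applied to `w ↦ g (z - w)`. -/
lemma wirtBar_cauchyInt {g : ℂ → ℂ} (hg : ContDiff ℝ ∞ g) (hc : HasCompactSupport g) (z : ℂ) :
    wirtBar (cauchyInt g) z = Real.pi * g z := by
  have h1 : wirtBar (cauchyInt g) z = cauchyInt (wirtBar g) z := by
    simp only [wirtBar, fderiv_cauchyInt hg hc]
    simp only [cauchyInt]
    rw [← integral_const_mul, ← integral_add, ← integral_div]
    · congr with w; simp only [wirtBar]; ring
    · exact integrable_cauchyInt_integrand (contDiff_fderiv_apply hg _).continuous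
        (hc.fderiv_apply ℝ _) z
    · exact (integrable_cauchyInt_integrand (contDiff_fderiv_apply hg _).continuous
        (hc.fderiv_apply ℝ _) z).const_mul _
  have h2 : ∀ w, wirtBar (fun w => g (z - w)) w = -wirtBar g (z - w) := by
    intro w
    have h := ((hg.differentiable (by simp)).differentiableAt (x := z - w)).hasFDerivAt.comp w
      ((hasFDerivAt_id w).const_sub z)
    have h' := h.fderiv
    simp only [Function.comp_def] at h'
    simp only [wirtBar, h', ContinuousLinearMap.comp_neg, ContinuousLinearMap.comp_id,
      neg_apply]
    ring
  have h3 := integral_inv_mul_wirtBar (h := fun w => g (z - w))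
    (hg.comp (contDiff_const.sub contDiff_id)) (hc.comp_homeomorph (Homeomorph.subLeft z))
  simp only [h2, mul_neg, integral_neg, neg_inj, sub_zero] at h3
  rw [h1, ← h3, cauchyInt]

/-! ### Decay of the Cauchy transform and its derivatives at infinity. -/

section Decay

variable {g : ℂ → ℂ}

lemma norm_mul_cauchyInt_le_of_far {ρ : ℝ} (hρ : ∀ w, g w ≠ 0 → ‖w‖ ≤ ρ)
    {z : ℂ} (hz : 2 * ρ ≤ ‖z‖) (hz0 : 0 < ‖z‖) (hi : Integrable g) :
    ‖cauchyInt g z‖ ≤ 2 * ‖z‖⁻¹ * ∫ w, ‖g w‖ := by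
  rw [cauchyInt_eq, ← integral_const_mul]
  refine norm_integral_le_of_norm_le (hi.norm.const_mul _) (.of_forall fun w => ?_)
  rw [norm_mul, norm_inv]
  by_cases hw : g w = 0
  · simp [hw]
  have h1 : ‖z‖ / 2 ≤ ‖z - w‖ := by
    have := hρ w hw
    have := norm_sub_norm_le z w
    linarith
  gcongr
  calc ‖z - w‖⁻¹ ≤ (‖z‖ / 2)⁻¹ := by gcongr
    _ = 2 * ‖z‖⁻¹ := by rw [inv_div]; ring

/-- Mean zero permits subtracting `z⁻¹` from the kernel; the difference `w / ((z - w) z)` gains one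
power of decay. -/
lemma norm_cauchyInt_le_of_far_of_integral_eq_zero {ρ : ℝ} (hρ0 : 0 ≤ ρ)
    (hρ : ∀ w, g w ≠ 0 → ‖w‖ ≤ ρ)
    (hg : Continuous g) (hc : HasCompactSupport g) (h0 : ∫ w, g w = 0)
    {z : ℂ} (hz : 2 * ρ ≤ ‖z‖) (hz0 : 0 < ‖z‖) :
    ‖cauchyInt g z‖ ≤ 2 * ρ * (‖z‖⁻¹) ^ 2 * ∫ w, ‖g w‖ := by
  have hi := hg.integrable_of_hasCompactSupport (μ := volume) hc
  have hk : Integrable fun w => (z - w)⁻¹ * g w := by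
    simpa using (integrable_cauchyInt_integrand hg hc z).comp_sub_left z
  have : cauchyInt g z = ∫ w, ((z - w)⁻¹ - z⁻¹) * g w := by
    simp only [sub_mul]
    rw [integral_sub hk (hi.const_mul _), integral_const_mul, h0, mul_zero, sub_zero, cauchyInt_eq]
  rw [this, ← integral_const_mul]
  refine norm_integral_le_of_norm_le (hi.norm.const_mul _) (.of_forall fun w => ?_)
  rw [norm_mul]
  by_cases hw : g w = 0
  · simp [hw]
  have hw1 := hρ w hw
  have h1 : ‖z‖ / 2 ≤ ‖z - w‖ := by
    have := norm_sub_norm_le z w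
    linarith
  have hz1 : z ≠ 0 := norm_pos_iff.1 hz0
  have hz2 : z - w ≠ 0 := norm_pos_iff.1 (by linarith)
  gcongr
  rw [inv_sub_inv hz2 hz1, sub_sub_cancel, norm_div, norm_mul]
  calc ‖w‖ / (‖z - w‖ * ‖z‖) ≤ ρ / (‖z‖ / 2 * ‖z‖) := by gcongr
    _ = 2 * ρ * (‖z‖⁻¹) ^ 2 := by field_simp

lemma exists_bound_support (hc : HasCompactSupport g) :
    ∃ ρ : ℝ, 1 ≤ ρ ∧ ∀ w, g w ≠ 0 → ‖w‖ ≤ ρ := by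
  obtain ⟨ρ, hρ⟩ := hc.isCompact.isBounded.subset_closedBall (0 : ℂ)
  refine ⟨max ρ 1, le_max_right _ _, fun w hw => le_trans ?_ (le_max_left _ _)⟩
  exact mem_closedBall_zero_iff.1 (hρ (subset_tsupport _ hw))

lemma exists_decay_of_far {f : ℂ → ℂ} (hf : Continuous f) (n : ℕ) {ρ A : ℝ} (hρ : 1 ≤ ρ)
    (hA : 0 ≤ A) (h : ∀ z, ρ ≤ ‖z‖ → ‖f z‖ ≤ A * (‖z‖⁻¹) ^ n) :
    ∃ C, 0 ≤ C ∧ ∀ z, ‖f z‖ ≤ C * ((1 + ‖z‖)⁻¹) ^ n := by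
  obtain ⟨B, hB⟩ := (isCompact_closedBall (0 : ℂ) ρ).exists_bound_of_continuousOn hf.continuousOn
  refine ⟨max (A * 2 ^ n) (B * (1 + ρ) ^ n), le_max_of_le_left (by positivity), fun z => ?_⟩
  rcases le_total ρ ‖z‖ with hz | hz
  · have hz0 : 0 < ‖z‖ := by linarith
    calc ‖f z‖ ≤ A * (‖z‖⁻¹) ^ n := h z hz
      _ ≤ A * (2 * (1 + ‖z‖)⁻¹) ^ n := by
        gcongr
        rw [← div_eq_mul_inv, inv_le_comm₀ hz0 (by positivity), inv_div,
          div_le_iff₀ (by norm_num)]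
        linarith
      _ = A * 2 ^ n * ((1 + ‖z‖)⁻¹) ^ n := by rw [mul_pow, mul_assoc]
      _ ≤ _ := by gcongr; exact le_max_left _ _
  · have h1 := hB z (mem_closedBall_zero_iff.2 hz)
    have hB0 : 0 ≤ B := (norm_nonneg _).trans h1
    calc ‖f z‖ ≤ B * 1 := by rw [mul_one]; exact h1
      _ ≤ B * ((1 + ρ) ^ n * ((1 + ‖z‖)⁻¹) ^ n) := by
        gcongr
        rw [← mul_pow]
        refine one_le_pow₀ ?_
        rw [← div_eq_mul_inv, one_le_div (by positivity)]
        linarith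
      _ = B * (1 + ρ) ^ n * ((1 + ‖z‖)⁻¹) ^ n := by ring
      _ ≤ _ := by gcongr; exact le_max_right _ _

lemma exists_decay_cauchyInt (hg : ContDiff ℝ ∞ g) (hc : HasCompactSupport g) :
    ∃ C, 0 ≤ C ∧ ∀ z, ‖cauchyInt g z‖ ≤ C * ((1 + ‖z‖)⁻¹) ^ 1 := by
  obtain ⟨ρ, hρ1, hρ⟩ := exists_bound_support hc
  refine exists_decay_of_far (contDiff_cauchyInt hg hc).continuous 1 (ρ := 2 * ρ)
    (A := 2 * ∫ w, ‖g w‖) (by linarith) (by positivity) fun z hz => ?_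
  refine (norm_mul_cauchyInt_le_of_far hρ hz (by linarith)
    (hg.continuous.integrable_of_hasCompactSupport hc)).trans (le_of_eq (by ring))

lemma exists_decay_cauchyInt_of_integral_eq_zero (hg : ContDiff ℝ ∞ g) (hc : HasCompactSupport g)
    (h0 : ∫ w, g w = 0) :
    ∃ C, 0 ≤ C ∧ ∀ z, ‖cauchyInt g z‖ ≤ C * ((1 + ‖z‖)⁻¹) ^ 2 := by
  obtain ⟨ρ, hρ1, hρ⟩ := exists_bound_support hc
  refine exists_decay_of_far (contDiff_cauchyInt hg hc).continuous 2 (ρ := 2 * ρ)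
    (A := 2 * ρ * ∫ w, ‖g w‖) (by linarith) (by positivity) fun z hz => ?_
  refine (norm_cauchyInt_le_of_far_of_integral_eq_zero (by linarith) hρ hg.continuous hc h0 hz
    (by linarith)).trans (le_of_eq (by ring))

lemma integral_fderiv_apply_eq_zero (hg : ContDiff ℝ ∞ g) (hc : HasCompactSupport g) (e : ℂ) :
    ∫ w, fderiv ℝ g w e = 0 := by
  have := integral_mul_fderiv_eq_neg_fderiv_mul_of_integrable (μ := volume) (f := fun _ => (1 : ℂ))
    (g := g) (v := e) (by simp) ?_ ?_ (fun _ _ => by fun_prop)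
    (fun _ _ => hg.differentiable (by simp) _)
  · simpa using this
  · simpa using (contDiff_fderiv_apply hg e).continuous.integrable_of_hasCompactSupport
      (hc.fderiv_apply ℝ e)
  · simpa using hg.continuous.integrable_of_hasCompactSupport hc

/-- Derivatives of the Cauchy transform are Cauchy transforms of derivatives of `g`, which have mean
zero, hence the second power. -/
lemma exists_decay_fderiv_cauchyInt (hg : ContDiff ℝ ∞ g) (hc : HasCompactSupport g) (e : ℂ) :
    ∃ C, 0 ≤ C ∧ ∀ z, ‖fderiv ℝ (cauchyInt g) z e‖ ≤ C * ((1 + ‖z‖)⁻¹) ^ 2 := by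
  simp only [fderiv_cauchyInt hg hc]
  exact exists_decay_cauchyInt_of_integral_eq_zero (contDiff_fderiv_apply hg e)
    (hc.fderiv_apply ℝ e) (integral_fderiv_apply_eq_zero hg hc e)

/-- Three powers of decay exceed the real dimension two. -/
lemma integrable_of_decay {E : Type*} [NormedAddCommGroup E] {f : ℂ → E} (hf : Continuous f) {C : ℝ}
    (h : ∀ z, ‖f z‖ ≤ C * ((1 + ‖z‖)⁻¹) ^ 3) : Integrable f := by
  have h1 : Integrable fun z : ℂ => (1 + ‖z‖) ^ (-3 : ℝ) :=
    integrable_one_add_norm (by simp; norm_num)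
  refine (h1.const_mul C).mono' hf.aestronglyMeasurable (.of_forall fun z => ?_)
  refine (h z).trans (le_of_eq ?_)
  rw [Real.rpow_neg (by positivity), inv_pow]
  norm_cast

end Decay

/-! ### The Beurling transform is an isometry of `L²`. -/

section Isometry

/-- The real bilinear form `(x, y) ↦ Im (x * conj y)`. -/
def imForm : ℂ →L[ℝ] ℂ →L[ℝ] ℝ :=
  (innerSL ℝ).comp (ContinuousLinearMap.mul ℝ ℂ (-Complex.I))

lemma imForm_apply (x y : ℂ) : imForm x y = x.im * y.re - x.re * y.im := by
  simp [imForm, Complex.inner]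
  ring

lemma norm_imForm_le (x y : ℂ) : ‖imForm x y‖ ≤ ‖x‖ * ‖y‖ := by
  simpa [imForm] using norm_inner_le_norm (𝕜 := ℝ) (-Complex.I * x) y

variable {g : ℂ → ℂ}

lemma fderiv_fderiv_comm (hg : ContDiff ℝ ∞ g) (z d e : ℂ) :
    fderiv ℝ (fun w => fderiv ℝ g w d) z e = fderiv ℝ (fun w => fderiv ℝ g w e) z d := by
  have hd : DifferentiableAt ℝ (fderiv ℝ g) z :=
    (hg.fderiv_right (m := ∞) (by simp)).differentiable (by simp) z
  rw [fderiv_clm_apply hd (differentiableAt_const _), fderiv_clm_apply hd (differentiableAt_const _)]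
  have := (hg.contDiffAt (x := z)).isSymmSndFDerivAt
    (by simpa using WithTop.coe_le_coe.2 (le_top : (2 : ℕ∞) ≤ ⊤))
  simpa using this e d

/-- The integrand is minus the Jacobian of the Cauchy transform, a null Lagrangian. Integrating by
parts in either order from the same mixed second derivative shows that the integral equals its own
negative, `imForm` being antisymmetric. Every product involved decays to order at least three, so
the integrations by parts have no boundary terms. -/
lemma integral_imForm_fderiv_eq_zero (hg : ContDiff ℝ ∞ g) (hc : HasCompactSupport g) :
    ∫ z, imForm (fderiv ℝ (cauchyInt g) z 1) (fderiv ℝ (cauchyInt g) z Complex.I) = 0 := by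
  set u := cauchyInt g
  have hu : ContDiff ℝ ∞ u := contDiff_cauchyInt hg hc
  obtain ⟨A, hA0, hA⟩ := exists_decay_cauchyInt hg hc
  have hD : ∀ e, ∃ C, 0 ≤ C ∧ ∀ z, ‖fderiv ℝ u z e‖ ≤ C * ((1 + ‖z‖)⁻¹) ^ 2 :=
    exists_decay_fderiv_cauchyInt hg hc
  have hDD : ∀ d e, ∃ C, 0 ≤ C ∧
      ∀ z, ‖fderiv ℝ (fun w => fderiv ℝ u w d) z e‖ ≤ C * ((1 + ‖z‖)⁻¹) ^ 2 := by
    intro d e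
    have : (fun w => fderiv ℝ u w d) = cauchyInt (fun w => fderiv ℝ g w d) := by
      ext w; exact fderiv_cauchyInt hg hc w d
    rw [this]
    exact exists_decay_fderiv_cauchyInt (contDiff_fderiv_apply hg d) (hc.fderiv_apply ℝ d) e
  have key : ∀ (f h : ℂ → ℂ) (k l : ℕ), 3 ≤ k + l → Continuous f → Continuous h →
      (∃ C, 0 ≤ C ∧ ∀ z, ‖f z‖ ≤ C * ((1 + ‖z‖)⁻¹) ^ k) →
      (∃ C, 0 ≤ C ∧ ∀ z, ‖h z‖ ≤ C * ((1 + ‖z‖)⁻¹) ^ l) →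
      Integrable fun z => imForm (f z) (h z) := by
    rintro f h k l hkl hf hh ⟨C, hC, hC'⟩ ⟨D, hD, hD'⟩
    refine integrable_of_decay (C := C * D) (by fun_prop) fun z => ?_
    calc _ ≤ ‖f z‖ * ‖h z‖ := norm_imForm_le _ _
      _ ≤ (C * ((1 + ‖z‖)⁻¹) ^ k) * (D * ((1 + ‖z‖)⁻¹) ^ l) := by
        gcongr
        exacts [hC' z, hD' z]
      _ = C * D * ((1 + ‖z‖)⁻¹) ^ (k + l) := by ring
      _ ≤ _ := by
        refine mul_le_mul_of_nonneg_left (pow_le_pow_of_le_one (by positivity) ?_ hkl)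
          (by positivity)
        exact inv_le_one_of_one_le₀ (by linarith [norm_nonneg z])
  have hc1 := fun e => (contDiff_fderiv_apply hu e).continuous
  have hc2 := fun d e => (contDiff_fderiv_apply (contDiff_fderiv_apply hu d) e).continuous
  have ibp : ∀ d e, ∫ z, imForm (u z) (fderiv ℝ (fun w => fderiv ℝ u w d) z e) =
      -∫ z, imForm (fderiv ℝ u z e) (fderiv ℝ u z d) := by
    intro d e
    refine integral_bilinear_fderiv_right_eq_neg_left_of_integrable ?_ ?_ ?_
      (fun _ _ => hu.differentiable (by simp) _)
      (fun _ _ => (contDiff_fderiv_apply hu d).differentiable (by simp) _)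
    · exact key _ _ 2 2 (by norm_num) (hc1 e) (hc1 d) (hD e) (hD d)
    · exact key _ _ 1 2 (by norm_num) hu.continuous (hc2 d e) ⟨A, hA0, hA⟩ (hDD d e)
    · exact key _ _ 1 2 (by norm_num) hu.continuous (hc1 d) ⟨A, hA0, hA⟩ (hD d)
  have h1 := ibp Complex.I 1
  have h2 := ibp 1 Complex.I
  have h3 : ∀ z, fderiv ℝ (fun w => fderiv ℝ u w Complex.I) z 1 =
    fderiv ℝ (fun w => fderiv ℝ u w 1) z Complex.I := fun z => fderiv_fderiv_comm hu z _ _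
  simp only [h3, h2, neg_inj] at h1
  have h4 : ∀ z, imForm (fderiv ℝ u z Complex.I) (fderiv ℝ u z 1) =
      -imForm (fderiv ℝ u z 1) (fderiv ℝ u z Complex.I) := by
    intro z; simp only [imForm_apply]; ring
  simp only [h4, integral_neg] at h1
  linarith

/-- The Beurling transform of `g`. -/
def beurling (g : ℂ → ℂ) (z : ℂ) : ℂ := (Real.pi : ℂ)⁻¹ * wirt (cauchyInt g) z

lemma contDiff_beurling (hg : ContDiff ℝ ∞ g) (hc : HasCompactSupport g) :
    ContDiff ℝ ∞ (beurling g) :=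
  contDiff_const.mul (contDiff_wirt (contDiff_cauchyInt hg hc))

lemma exists_decay_beurling (hg : ContDiff ℝ ∞ g) (hc : HasCompactSupport g) :
    ∃ C, 0 ≤ C ∧ ∀ z, ‖beurling g z‖ ≤ C * ((1 + ‖z‖)⁻¹) ^ 2 := by
  obtain ⟨A, hA0, hA⟩ := exists_decay_fderiv_cauchyInt hg hc 1
  obtain ⟨B, hB0, hB⟩ := exists_decay_fderiv_cauchyInt hg hc Complex.I
  refine ⟨‖(Real.pi : ℂ)⁻¹‖ * ((A + B) / 2), by positivity, fun z => ?_⟩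
  have h : ‖wirt (cauchyInt g) z‖ ≤ (A + B) / 2 * ((1 + ‖z‖)⁻¹) ^ 2 := by
    have h2 : ‖fderiv ℝ (cauchyInt g) z 1 - Complex.I * fderiv ℝ (cauchyInt g) z Complex.I‖ ≤
        A * ((1 + ‖z‖)⁻¹) ^ 2 + B * ((1 + ‖z‖)⁻¹) ^ 2 := by
      refine (norm_sub_le _ _).trans (add_le_add (hA z) ?_)
      rw [norm_mul, Complex.norm_I, one_mul]
      exact hB z
    rw [wirt, norm_div, Complex.norm_ofNat, div_le_iff₀ (by norm_num)]
    linarith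
  rw [beurling, norm_mul, mul_assoc]
  exact mul_le_mul_of_nonneg_left h (norm_nonneg _)

/-- With `u` the Cauchy transform, `|∂u|² - |∂̄u|²` is the Jacobian of `u`, whose integral vanishes.
-/
lemma lintegral_enorm_beurling_sq (hg : ContDiff ℝ ∞ g) (hc : HasCompactSupport g) :
    ∫⁻ z, ‖beurling g z‖ₑ ^ 2 = ∫⁻ z, ‖g z‖ₑ ^ 2 := by
  have hi1 : Integrable fun z => ‖beurling g z‖ ^ 2 := by
    obtain ⟨C, hC0, hC⟩ := exists_decay_beurling hg hc
    refine integrable_of_decay (C := C ^ 2) ((contDiff_beurling hg hc).continuous.norm.pow 2)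
      fun z => ?_
    rw [norm_pow, norm_norm]
    calc ‖beurling g z‖ ^ 2 ≤ (C * ((1 + ‖z‖)⁻¹) ^ 2) ^ 2 := by gcongr; exact hC z
      _ = C ^ 2 * ((1 + ‖z‖)⁻¹) ^ 4 := by ring
      _ ≤ _ := by
        refine mul_le_mul_of_nonneg_left (pow_le_pow_of_le_one (by positivity) ?_ (by norm_num))
          (by positivity)
        exact inv_le_one_of_one_le₀ (by linarith [norm_nonneg z])
  have hi2 : Integrable fun z => ‖g z‖ ^ 2 := by
    refine (hg.continuous.norm.pow 2).integrable_of_hasCompactSupport ?_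
    refine hc.mono fun z hz hz' => hz ?_
    simp [hz']
  have key : ∫ z, ‖beurling g z‖ ^ 2 = ∫ z, ‖g z‖ ^ 2 := by
    rw [← sub_eq_zero, ← integral_sub hi1 hi2]
    have h0 := integral_imForm_fderiv_eq_zero hg hc
    rw [← mul_zero (-(Real.pi ^ 2)⁻¹), ← h0, ← integral_const_mul]
    congr with z
    have h1 : g z = (Real.pi : ℂ)⁻¹ * wirtBar (cauchyInt g) z := by
      rw [wirtBar_cauchyInt hg hc, inv_mul_cancel_left₀ (by simp [Real.pi_ne_zero])]
    rw [beurling, h1, wirt, wirtBar, imForm_apply]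
    simp only [norm_mul, mul_pow, norm_div, div_pow, ← Complex.normSq_eq_norm_sq]
    simp [Complex.normSq_apply]
    field_simp
    ring
  have conv : ∀ f : ℂ → ℂ, Integrable (fun z => ‖f z‖ ^ 2) →
      ∫⁻ z, ‖f z‖ₑ ^ 2 = ENNReal.ofReal (∫ z, ‖f z‖ ^ 2) := by
    intro f hf
    rw [ofReal_integral_eq_lintegral_ofReal hf (.of_forall fun z => by positivity)]
    congr with z
    rw [ENNReal.ofReal_pow (norm_nonneg _), ofReal_norm]
  rw [conv _ hi1, conv _ hi2, key]

end Isometry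

/-! ### Mean value inequality for holomorphic functions. -/

section MeanValue

lemma lintegral_Ioo_ofReal {ρ : ℝ} (hρ : 0 < ρ) :
    ∫⁻ r in Ioo 0 ρ, ENNReal.ofReal r = ENNReal.ofReal (ρ ^ 2 / 2) := by
  rw [← ofReal_integral_eq_lintegral_ofReal]
  · rw [← integral_Ioc_eq_integral_Ioo, ← intervalIntegral.integral_of_le hρ.le, integral_id]
    simp
  · exact (continuous_id.integrableOn_Icc (a := 0) (b := ρ)).mono_set Ioo_subset_Icc_self
  · filter_upwards [ae_restrict_mem measurableSet_Ioo] with r hr using hr.1.le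

/-- The sub-mean value property of `‖h‖ ^ 2` on discs, for holomorphic `h`. -/
lemma enorm_sq_mul_le_lintegral_ball {h : ℂ → ℂ} (hcont : Continuous h) {x : ℂ} {ρ : ℝ}
    (hρ : 0 < ρ) (hd : DifferentiableOn ℂ h (ball x ρ)) :
    ‖h x‖ₑ ^ 2 * ENNReal.ofReal (Real.pi * ρ ^ 2) ≤ ∫⁻ y in ball x ρ, ‖h y‖ₑ ^ 2 := by
  have circ : ∀ r ∈ Ioo 0 ρ, ENNReal.ofReal (2 * Real.pi) * ‖h x‖ₑ ^ 2 ≤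
      ∫⁻ θ in Ioo (-Real.pi) Real.pi, ‖h (circleMap x r θ)‖ₑ ^ 2 := by
    intro r hr
    -- The mean value property is applied to the holomorphic function `h²`, so the triangle
    -- inequality alone yields the bound for `|h|²`.
    have h1 : DiffContOnCl ℂ (fun z => h z ^ 2) (ball x |r|) := by
      refine ⟨(hd.mono ?_).pow 2, (hcont.pow 2).continuousOn⟩
      rw [abs_of_pos hr.1]
      exact ball_subset_ball hr.2.le
    have h2 := h1.circleAverage
    rw [Real.circleAverage_eq_integral_add (-Real.pi),
      intervalIntegral.integral_comp_add_right (fun θ => h (circleMap x r θ) ^ 2), zero_add,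
      show 2 * Real.pi + -Real.pi = Real.pi by ring,
      intervalIntegral.integral_of_le (by linarith [Real.pi_pos]),
      integral_Ioc_eq_integral_Ioo, inv_smul_eq_iff₀ (by positivity)] at h2
    have h3 := enorm_integral_le_lintegral_enorm (μ := volume.restrict (Ioo (-Real.pi) Real.pi))
      fun θ => h (circleMap x r θ) ^ 2
    rw [h2, enorm_smul, Real.enorm_of_nonneg (by positivity)] at h3
    simpa only [enorm_pow] using h3
  calc ‖h x‖ₑ ^ 2 * ENNReal.ofReal (Real.pi * ρ ^ 2)
      = ∫⁻ r in Ioo 0 ρ, ENNReal.ofReal r * (ENNReal.ofReal (2 * Real.pi) * ‖h x‖ₑ ^ 2) := by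
        rw [lintegral_mul_const _ (by fun_prop), lintegral_Ioo_ofReal hρ, ← mul_assoc,
          ← ENNReal.ofReal_mul (by positivity), mul_comm]
        congr 2
        ring
    _ ≤ ∫⁻ r in Ioo 0 ρ, ENNReal.ofReal r *
          ∫⁻ θ in Ioo (-Real.pi) Real.pi, ‖h (circleMap x r θ)‖ₑ ^ 2 :=
        setLIntegral_mono' measurableSet_Ioo fun r hr => mul_le_mul_right (circ r hr) _
    _ = ∫⁻ r in Ioo 0 ρ, 
          ∫⁻ θ in Ioo (-Real.pi) Real.pi, ENNReal.ofReal r * ‖h (circleMap x r θ)‖ₑ ^ 2 := by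
        congr with r
        rw [lintegral_const_mul]
        exact ((hcont.comp (continuous_circleMap x r)).measurable.enorm.pow_const 2)
    _ = ∫⁻ p in Ioo 0 ρ ×ˢ Ioo (-Real.pi) Real.pi,
          ENNReal.ofReal p.1 * ‖h (circleMap x p.1 p.2)‖ₑ ^ 2 := by
        rw [Measure.volume_eq_prod, ← Measure.prod_restrict, lintegral_prod]
        unfold circleMap
        fun_prop
    _ ≤ ∫⁻ p in polarCoord.target, ENNReal.ofReal p.1 •
          ((ball x ρ).indicator (fun y => ‖h y‖ₑ ^ 2) (Complex.polarCoord.symm p + x)) := by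
        refine (setLIntegral_mono' (measurableSet_Ioo.prod measurableSet_Ioo) ?_).trans
          (lintegral_mono_set (prod_mono Ioo_subset_Ioi_self le_rfl))
        rintro ⟨r, θ⟩ ⟨hr, -⟩
        have hc : Complex.polarCoord.symm (r, θ) + x = circleMap x r θ := by
          rw [circleMap, Complex.exp_mul_I, add_comm]
          simp
        have hm : circleMap x r θ ∈ ball x ρ := by
          rw [mem_ball, dist_eq_norm, circleMap_sub_center, norm_circleMap_zero, abs_of_pos hr.1]
          exact hr.2
        rw [hc, indicator_of_mem hm, smul_eq_mul]
    _ = ∫⁻ y in ball x ρ, ‖h y‖ₑ ^ 2 := by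
        rw [Complex.lintegral_comp_polarCoord_symm
          (fun w => (ball x ρ).indicator (fun y => ‖h y‖ₑ ^ 2) (w + x)),
          lintegral_add_right_eq_self, lintegral_indicator measurableSet_ball]

end MeanValue

lemma ENNReal_add_sq_le (a b : ℝ≥0∞) : (a + b) ^ 2 ≤ 2 * a ^ 2 + 2 * b ^ 2 := by
  have := ENNReal.rpow_add_le_mul_rpow_add_rpow a b (p := 2) (by norm_num)
  norm_num at this
  rw [← mul_add]
  exact_mod_cast this

/-! ### Local decomposition of the Beurling transform. -/

section Local

variable {g : ℂ → ℂ}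

lemma fderiv_eq_of_wirtBar_eq_zero {u : ℂ → ℂ} {z : ℂ} (h : wirtBar u z = 0) :
    fderiv ℝ u z Complex.I = Complex.I • fderiv ℝ u z 1 := by
  have h1 : fderiv ℝ u z 1 + Complex.I * fderiv ℝ u z Complex.I = 0 := by
    simpa [wirtBar] using h
  rw [smul_eq_mul]
  linear_combination (-Complex.I) * h1 + fderiv ℝ u z Complex.I * Complex.I_sq

/-- Off the support of `g` the Cauchy transform satisfies the Cauchy–Riemann equations, and there
`beurling g` is `π⁻¹` times its complex derivative. -/
lemma differentiableOn_beurling (hg : ContDiff ℝ ∞ g) (hc : HasCompactSupport g) {U : Set ℂ}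
    (hU : IsOpen U) (h0 : ∀ z ∈ U, g z = 0) : DifferentiableOn ℂ (beurling g) U := by
  have hu := contDiff_cauchyInt hg hc
  have hbar : ∀ z ∈ U, wirtBar (cauchyInt g) z = 0 := fun z hz => by
    rw [wirtBar_cauchyInt hg hc, h0 z hz, mul_zero]
  have h1 : DifferentiableOn ℂ (cauchyInt g) U := fun z hz =>
    (differentiableAt_complex_iff_differentiableAt_real.2 ⟨hu.differentiable (by simp) z,
      fderiv_eq_of_wirtBar_eq_zero (hbar z hz)⟩).differentiableWithinAt
  refine ((h1.deriv hU).const_mul (Real.pi : ℂ)⁻¹).congr fun z hz => ?_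
  have h2 : deriv (cauchyInt g) z = fderiv ℝ (cauchyInt g) z 1 := by
    rw [((h1 z hz).differentiableAt (hU.mem_nhds hz)).fderiv_restrictScalars ℝ]
    simp
  rw [beurling, wirt, fderiv_eq_of_wirtBar_eq_zero (hbar z hz), h2, smul_eq_mul]
  congr 1
  linear_combination (-fderiv ℝ (cauchyInt g) z 1 / 2) * Complex.I_sq

lemma beurling_add {f : ℂ → ℂ} (hf : ContDiff ℝ ∞ f) (hfc : HasCompactSupport f)
    (hg : ContDiff ℝ ∞ g) (hgc : HasCompactSupport g) (z : ℂ) :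
    beurling (f + g) z = beurling f z + beurling g z := by
  have h := cauchyInt_add hf.continuous hfc hg.continuous hgc
  have hd := fderiv_add ((contDiff_cauchyInt hf hfc).differentiable (by simp) z)
    ((contDiff_cauchyInt hg hgc).differentiable (by simp) z)
  rw [beurling, beurling, beurling, wirt, wirt, wirt, h, hd]
  simp only [add_apply]
  ring

/-- Near a disc, the Beurling transform of `g` is the sum of a function with an `L²` bound by `g`
and a function with a uniform bound. -/
lemma exists_local_decomposition (hg : ContDiff ℝ ∞ g) (hc : HasCompactSupport g) (x : ℂ) {r : ℝ}
    (hr : 0 < r) :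
    ∃ P : ℂ → ℝ≥0∞, Measurable P ∧ ∫⁻ y, P y ≤ ∫⁻ y in closedBall x (20 * r), ‖g y‖ₑ ^ 2 ∧
      ∀ y ∈ closedBall x (5 * r), ‖beurling g y‖ₑ ^ 2 ≤ 2 * P y + (ENNReal.ofReal (r ^ 2))⁻¹ *
        ((∫⁻ y in closedBall x (20 * r), ‖beurling g y‖ₑ ^ 2) +
          ∫⁻ y in closedBall x (20 * r), ‖g y‖ₑ ^ 2) := by
  -- The cutoff is `1` on radius `10r`: for `y` within `5r` of `x`, the disc of radius `5r` about
  -- `y` stays where `g₂` vanishes, so `beurling g₂` is holomorphic on it.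
  let χ : ContDiffBump x := ⟨10 * r, 20 * r, by positivity, by linarith⟩
  let g₁ : ℂ → ℂ := fun z => χ z * g z
  let g₂ : ℂ → ℂ := fun z => (1 - χ z) * g z
  have hχ : ContDiff ℝ ∞ fun z => (χ z : ℂ) := Complex.ofRealCLM.contDiff.comp χ.contDiff
  have h1 : ContDiff ℝ ∞ g₁ := hχ.mul hg
  have h2 : ContDiff ℝ ∞ g₂ := (contDiff_const.sub hχ).mul hg
  have hc1 : HasCompactSupport g₁ := hc.mul_left
  have hc2 : HasCompactSupport g₂ := hc.mul_left
  have hsum : g = g₁ + g₂ := by ext z; simp only [g₁, g₂, Pi.add_apply]; ring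
  have hle : ∫⁻ y, ‖beurling g₁ y‖ₑ ^ 2 ≤ ∫⁻ y in closedBall x (20 * r), ‖g y‖ₑ ^ 2 := by
    rw [lintegral_enorm_beurling_sq h1 hc1, ← lintegral_indicator isClosed_closedBall.measurableSet]
    refine lintegral_mono fun y => ?_
    by_cases hy : y ∈ closedBall x (20 * r)
    · rw [indicator_of_mem hy]
      have : ‖g₁ y‖ ≤ ‖g y‖ := by
        rw [norm_mul, Complex.norm_real, Real.norm_of_nonneg χ.nonneg]
        exact mul_le_of_le_one_left (norm_nonneg _) χ.le_one
      gcongr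
      exact enorm_le_iff_norm_le.2 this
    · have : χ y = 0 := χ.zero_of_le_dist (by
        rw [mem_closedBall, not_le] at hy; exact hy.le)
      simp [g₁, this]
  have hF : ∀ y, beurling g y = beurling g₁ y + beurling g₂ y := fun y => by
    conv_lhs => rw [hsum]
    exact beurling_add h1 hc1 h2 hc2 y
  have hm1 : Measurable fun y => ‖beurling g₁ y‖ₑ ^ 2 :=
    ((contDiff_beurling h1 hc1).continuous.measurable.enorm.pow_const 2)
  have hm : Measurable fun y => ‖beurling g y‖ₑ ^ 2 :=
    ((contDiff_beurling hg hc).continuous.measurable.enorm.pow_const 2)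
  refine ⟨fun y => ‖beurling g₁ y‖ₑ ^ 2, hm1, hle, fun y hy => ?_⟩
  set A := ∫⁻ y in closedBall x (20 * r), ‖beurling g y‖ₑ ^ 2
  set B := ∫⁻ y in closedBall x (20 * r), ‖g y‖ₑ ^ 2
  have hsub : ball y (5 * r) ⊆ ball x (10 * r) := by
    refine ball_subset_ball' ?_
    rw [mem_closedBall] at hy
    linarith
  have hmv := enorm_sq_mul_le_lintegral_ball (contDiff_beurling h2 hc2).continuous
    (x := y) (ρ := 5 * r) (by positivity)
    (differentiableOn_beurling h2 hc2 isOpen_ball fun z hz => by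
      have : χ z = 1 := χ.one_of_mem_closedBall (ball_subset_closedBall (hsub hz))
      simp [g₂, this])
  have hup : ∫⁻ y in ball y (5 * r), ‖beurling g₂ y‖ₑ ^ 2 ≤ 2 * (A + B) := by
    calc _ ≤ ∫⁻ y in ball y (5 * r), (2 * ‖beurling g y‖ₑ ^ 2 + 2 * ‖beurling g₁ y‖ₑ ^ 2) := by
          refine lintegral_mono fun z => ?_
          have : beurling g₂ z = beurling g z - beurling g₁ z := by rw [hF]; ring
          rw [this]
          exact (pow_le_pow_left₀ zero_le (enorm_sub_le) 2).trans (ENNReal_add_sq_le _ _)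
      _ = 2 * (∫⁻ y in ball y (5 * r), ‖beurling g y‖ₑ ^ 2) +
          2 * ∫⁻ y in ball y (5 * r), ‖beurling g₁ y‖ₑ ^ 2 := by
          rw [lintegral_add_left (hm.const_mul 2), lintegral_const_mul _ hm,
            lintegral_const_mul _ hm1]
      _ ≤ 2 * A + 2 * B := by
          gcongr
          · exact lintegral_mono_set (hsub.trans (ball_subset_closedBall.trans
              (closedBall_subset_closedBall (by linarith))))
          · exact (setLIntegral_le_lintegral _ _).trans hle
      _ = 2 * (A + B) := by ring
  have hr2 : ENNReal.ofReal (r ^ 2) ≠ 0 := by simpa using hr.ne'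
  have hbd : 2 * ‖beurling g₂ y‖ₑ ^ 2 ≤ (ENNReal.ofReal (r ^ 2))⁻¹ * (A + B) := by
    rw [mul_comm (ENNReal.ofReal (r ^ 2))⁻¹, ← div_eq_mul_inv,
      ENNReal.le_div_iff_mul_le (.inl hr2) (.inl ENNReal.ofReal_ne_top)]
    -- The disc has area `25πr²`; keeping only `4r²` already gives the constant `1` in the
    -- statement.
    have h3 : ‖beurling g₂ y‖ₑ ^ 2 * ENNReal.ofReal (4 * r ^ 2) ≤ 2 * (A + B) := by
      refine le_trans ?_ (hmv.trans hup)
      refine mul_le_mul_right (ENNReal.ofReal_le_ofReal ?_) _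
      nlinarith [Real.pi_gt_three, sq_pos_of_pos hr]
    rw [ENNReal.ofReal_mul (by norm_num)] at h3
    norm_num at h3
    rw [← ENNReal.mul_le_mul_iff_right (a := 2) (by norm_num) (by norm_num)]
    refine le_trans (le_of_eq ?_) h3
    ring
  calc ‖beurling g y‖ₑ ^ 2 ≤ (‖beurling g₁ y‖ₑ + ‖beurling g₂ y‖ₑ) ^ 2 := by
        rw [hF]; gcongr; exact enorm_add_le _ _
    _ ≤ 2 * ‖beurling g₁ y‖ₑ ^ 2 + 2 * ‖beurling g₂ y‖ₑ ^ 2 := ENNReal_add_sq_le _ _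
    _ ≤ _ := by gcongr

end Local

/-! ### Stopping radii, Vitali covering and the level set inequality. -/

section LevelSets

variable {G H : ℂ → ℝ≥0}

lemma setLIntegral_le_superlevel_add {f : ℂ → ℝ≥0} (hf : Measurable f) {S : Set ℂ}
    (hS : MeasurableSet S) (c : ℝ≥0) :
    ∫⁻ y in S, f y ≤ (∫⁻ y in S ∩ {y | c < f y}, f y) + c * volume S := by
  have hm : MeasurableSet {y | c < f y} := measurableSet_lt measurable_const hf
  rw [← lintegral_inter_add_sdiff _ S hm]
  refine add_le_add le_rfl ?_
  calc ∫⁻ y in S \ {y | c < f y}, f y ≤ ∫⁻ y in S \ {y | c < f y}, c := by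
        refine setLIntegral_mono' (hS.diff hm) fun y hy => ?_
        exact_mod_cast not_lt.1 hy.2
    _ ≤ c * volume S := by
        rw [setLIntegral_const]
        gcongr
        exact sdiff_subset

/-- Existence of a stopping radius. -/
lemma exists_stopping_radius {W : ℂ → ℝ≥0} (hW : Continuous W) (hWi : ∫⁻ y, W y ≠ ⊤) {l : ℝ≥0}
    (hl : 0 < l) {x : ℂ} (hx : l < W x) :
    ∃ r : ℝ, 0 < r ∧ l * volume (closedBall x r) ≤ ∫⁻ y in closedBall x r, W y ∧
      ∫⁻ y in closedBall x (20 * r), W y ≤ l * volume (closedBall x (20 * r)) := by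
  -- Without a stopping radius, an average at least `l` at radius `r` persists at `20r`, hence at
  -- all radii `20ⁿ r₀/2`; the integral of `W` would then exceed `l` times arbitrarily large areas.
  by_contra! hcon
  obtain ⟨r₀, hr₀, hball⟩ := Metric.isOpen_iff.1 (isOpen_lt continuous_const hW) x hx
  have h0 : ∀ n : ℕ, l * volume (closedBall x (20 ^ n * (r₀ / 2))) ≤
      ∫⁻ y in closedBall x (20 ^ n * (r₀ / 2)), W y := by
    intro n
    induction n with
    | zero =>
      rw [pow_zero, one_mul, ← setLIntegral_const]
      refine setLIntegral_mono' measurableSet_closedBall fun y hy => ?_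
      have : l < W y := hball (closedBall_subset_ball (by linarith) hy)
      exact_mod_cast this.le
    | succ n ih =>
      have := hcon _ (by positivity) ih
      rw [pow_succ', mul_assoc]
      exact this.le
  have h1 : ∀ n : ℕ, (l * ENNReal.ofReal (r₀ / 2) ^ 2 * NNReal.pi) * n ≤ ∫⁻ y, W y := by
    intro n
    refine le_trans ?_ ((h0 n).trans (setLIntegral_le_lintegral _ _))
    have hn : (n : ℝ≥0∞) ≤ (20 ^ n) ^ 2 := by
      rw [← pow_mul]
      calc (n : ℝ≥0∞) ≤ ((2 ^ n : ℕ) : ℝ≥0∞) := by exact_mod_cast Nat.lt_two_pow_self.le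
        _ = 2 ^ n := by push_cast; rfl
        _ ≤ 20 ^ n := by gcongr; norm_num
        _ ≤ 20 ^ (n * 2) := by gcongr; exacts [by norm_num, by omega]
    rw [Complex.volume_closedBall, ENNReal.ofReal_mul (by positivity),
      ENNReal.ofReal_pow (by norm_num), mul_pow, ENNReal.ofReal_ofNat]
    calc _ = l * (n * ENNReal.ofReal (r₀ / 2) ^ 2 * NNReal.pi) := by ring
      _ ≤ l * ((20 ^ n) ^ 2 * ENNReal.ofReal (r₀ / 2) ^ 2 * NNReal.pi) := by gcongr
  have hc0 : (l * ENNReal.ofReal (r₀ / 2) ^ 2 * NNReal.pi : ℝ≥0∞) ≠ 0 := by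
    have : 0 < r₀ / 2 := by positivity
    simp [hl.ne', this, NNReal.pi_ne_zero]
  have ht : Filter.Tendsto (fun n : ℕ => (l * ENNReal.ofReal (r₀ / 2) ^ 2 * NNReal.pi) *
      (n : ℝ≥0∞)) Filter.atTop (nhds ⊤) := by
    have := ENNReal.Tendsto.const_mul (a := (l * ENNReal.ofReal (r₀ / 2) ^ 2 * NNReal.pi : ℝ≥0∞))
      ENNReal.tendsto_nat_nhds_top (.inl ENNReal.top_ne_zero)
    rwa [ENNReal.mul_top hc0] at this
  exact hWi (top_le_iff.1 (le_of_tendsto' ht h1))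

/-- The Vitali covering lemma needs uniformly bounded radii. Here `l r² ≤ ∫ W`, and `r² ≤ K` implies
`r ≤ K + 1`. -/
lemma exists_radius_bound {W : ℂ → ℝ≥0} (hWi : ∫⁻ y, W y ≠ ⊤) {l : ℝ≥0} (hl : 0 < l) :
    ∃ R : ℝ, ∀ x : ℂ, ∀ r : ℝ, l * volume (closedBall x r) ≤ ∫⁻ y in closedBall x r, W y →
      r ≤ R := by
  set K := (∫⁻ y, W y).toReal / l
  refine ⟨K + 1, fun x r hr => ?_⟩
  rcases le_or_gt r 0 with h | h
  · exact h.trans (by positivity)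
  have h1 : (l : ℝ≥0∞) * ENNReal.ofReal (r ^ 2) ≤ ∫⁻ y, W y := by
    refine le_trans ?_ (hr.trans (setLIntegral_le_lintegral _ _))
    rw [Complex.volume_closedBall, ENNReal.ofReal_pow h.le]
    gcongr
    refine le_mul_of_one_le_right zero_le ?_
    exact_mod_cast (by linarith [Real.pi_gt_three] : (1 : ℝ) ≤ Real.pi)
  have h2 := ENNReal.toReal_mono hWi h1
  rw [ENNReal.toReal_mul, ENNReal.toReal_ofReal (by positivity), ENNReal.coe_toReal] at h2
  have hl' : (0 : ℝ) < l := hl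
  have h3 : r ^ 2 ≤ K := by
    rw [le_div_iff₀ hl']
    linarith
  nlinarith

/-- The good-`λ` type inequality behind the Calderón–Zygmund estimate. -/
lemma lintegral_superlevel_le (hG : Continuous G) (hH : Continuous H) (hGi : ∫⁻ y, G y ≠ ⊤)
    (hHi : ∫⁻ y, H y ≠ ⊤)
    (hloc : ∀ x : ℂ, ∀ r : ℝ, 0 < r → ∃ P : ℂ → ℝ≥0∞, Measurable P ∧
      ∫⁻ y, P y ≤ ∫⁻ y in closedBall x (20 * r), H y ∧
      ∀ y ∈ closedBall x (5 * r), G y ≤ 2 * P y + (ENNReal.ofReal (r ^ 2))⁻¹ *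
        ((∫⁻ y in closedBall x (20 * r), G y) + ∫⁻ y in closedBall x (20 * r), H y))
    {M l : ℝ≥0} (hM : 1 ≤ M) (hl : 0 < l) :
    M * ∫⁻ y in {y | 3200 * l < G y}, G y ≤
      3200 * ((∫⁻ y in {y | l / 4 < G y}, G y) + M * ∫⁻ y in {y | l / (4 * M) < H y}, H y) := by
  have hM0 : M ≠ 0 := (zero_lt_one.trans_le hM).ne'
  set W : ℂ → ℝ≥0 := fun y => G y + M * H y
  have hWc : Continuous W := by fun_prop
  have hGm : Measurable fun y => (G y : ℝ≥0∞) := hG.measurable.coe_nnreal_ennreal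
  have hHm : Measurable fun y => (H y : ℝ≥0∞) := hH.measurable.coe_nnreal_ennreal
  have hWint : ∀ S : Set ℂ, ∫⁻ y in S, W y = (∫⁻ y in S, G y) + M * ∫⁻ y in S, H y := by
    intro S
    simp only [W, ENNReal.coe_add, ENNReal.coe_mul]
    rw [lintegral_add_left hGm, lintegral_const_mul _ hHm]
  have hWi : ∫⁻ y, W y ≠ ⊤ := by
    have := hWint univ
    simp only [Measure.restrict_univ] at this
    rw [this]
    exact ENNReal.add_ne_top.2 ⟨hGi, ENNReal.mul_ne_top ENNReal.coe_ne_top hHi⟩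
  set E : Set ℂ := {y | l < G y}
  set E' : Set ℂ := {y | 3200 * l < G y}
  set S₁ : Set ℂ := {y | l / 4 < G y}
  set S₂ : Set ℂ := {y | l / (4 * M) < H y}
  have hE' : MeasurableSet E' := measurableSet_lt measurable_const hG.measurable
  have hS₁ : MeasurableSet S₁ := measurableSet_lt measurable_const hG.measurable
  have hS₂ : MeasurableSet S₂ := measurableSet_lt measurable_const hH.measurable
  have hex : ∀ x ∈ E, ∃ r : ℝ, 0 < r ∧ l * volume (closedBall x r) ≤ ∫⁻ y in closedBall x r, W y ∧
      ∫⁻ y in closedBall x (20 * r), W y ≤ l * volume (closedBall x (20 * r)) := fun x hx =>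
    exists_stopping_radius hWc hWi hl (lt_of_lt_of_le hx (le_add_of_nonneg_right zero_le))
  choose! r hr0 hr1 hr2 using hex
  obtain ⟨R, hR⟩ := exists_radius_bound hWi hl
  obtain ⟨u, huE, hdisj, hcov⟩ := Vitali.exists_disjoint_subfamily_covering_enlargement_closedBall
    E id r R (fun x hx => hR x _ (hr1 x hx)) 5 (by norm_num)
  simp only [id] at hdisj hcov
  have hu : u.Countable := hdisj.countable_of_nonempty_interior fun x hx => by
    refine ⟨x, ?_⟩
    exact ball_subset_interior_closedBall (mem_ball_self (hr0 x (huE hx)))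
  have hvol : ∀ x ∈ u, volume (closedBall x (r x)) ≠ ⊤ := fun x _ =>
    isCompact_closedBall _ _ |>.measure_lt_top.ne
  -- the estimate on one ball, inside
  have hin : ∀ x ∈ u, l * volume (closedBall x (r x)) ≤
      2 * ((∫⁻ y in closedBall x (r x) ∩ S₁, G y) + M * ∫⁻ y in closedBall x (r x) ∩ S₂, H y) := by
    intro x hx
    set V := volume (closedBall x (r x))
    set a := ∫⁻ y in closedBall x (r x) ∩ S₁, (G y : ℝ≥0∞)
    set b := ∫⁻ y in closedBall x (r x) ∩ S₂, (H y : ℝ≥0∞)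
    have h1 := hr1 x (huE hx)
    rw [hWint] at h1
    -- Below the levels `l/4` and `l/(4M)`, the functions `G` and `M H` contribute at most `lV/4`
    -- each, so together half of `lV`, which is absorbed.
    have h2 := setLIntegral_le_superlevel_add hG.measurable (measurableSet_closedBall (x := x) (ε := r x)) (l / 4)
    have h3 := setLIntegral_le_superlevel_add hH.measurable (measurableSet_closedBall (x := x) (ε := r x)) (l / (4 * M))
    have h4 : (l : ℝ≥0∞) * V ≤ (a + M * b) + (l : ℝ≥0∞) * V / 2 := by
      refine h1.trans ((add_le_add h2 (mul_le_mul_right h3 _)).trans (le_of_eq ?_))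
      have e1 : (l : ℝ≥0∞) * V / 2 = ((l / 4 : ℝ≥0) : ℝ≥0∞) * V + M * ((l / (4 * M) : ℝ≥0) * V) := by
        rw [← mul_assoc, ← add_mul, ← ENNReal.coe_mul, ← ENNReal.coe_add,
          ENNReal.mul_div_right_comm]
        congr 1
        rw [show l / 4 + M * (l / (4 * M)) = l / 2 by field_simp; norm_num]
        rw [ENNReal.coe_div (by norm_num)]
        simp
      rw [e1]
      ring
    have hfin : (l : ℝ≥0∞) * V / 2 ≠ ⊤ :=
      ENNReal.div_ne_top (ENNReal.mul_ne_top ENNReal.coe_ne_top (hvol x hx)) (by norm_num)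
    have h5 : (l : ℝ≥0∞) * V / 2 ≤ a + M * b := by
      rw [← ENNReal.add_le_add_iff_right hfin, ENNReal.add_halves]
      exact h4
    calc (l : ℝ≥0∞) * V = 2 * ((l : ℝ≥0∞) * V / 2) := by
          rw [ENNReal.mul_div_cancel (by norm_num) (by norm_num)]
      _ ≤ _ := by gcongr
  -- the estimate on one ball, outside
  have hout : ∀ x ∈ u, M * ∫⁻ y in closedBall x (5 * r x) ∩ E', G y ≤
      1600 * (l * volume (closedBall x (r x))) := by
    intro x hx
    have hrx := hr0 x (huE hx)
    obtain ⟨P, hPm, hP, hGP⟩ := hloc x (r x) hrx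
    have h2 := hr2 x (huE hx)
    rw [hWint] at h2
    set A := ∫⁻ y in closedBall x (20 * r x), (G y : ℝ≥0∞)
    set B := ∫⁻ y in closedBall x (20 * r x), (H y : ℝ≥0∞)
    have hv : volume (closedBall x (20 * r x)) = 400 * volume (closedBall x (r x)) := by
      rw [Complex.volume_closedBall, Complex.volume_closedBall, ENNReal.ofReal_mul (by norm_num),
        mul_pow, mul_assoc]
      norm_num
    have hv2 : volume (closedBall x (20 * r x)) ≤ 1600 * ENNReal.ofReal (r x ^ 2) := by
      rw [hv, Complex.volume_closedBall, ENNReal.ofReal_pow hrx.le]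
      have : (NNReal.pi : ℝ≥0∞) ≤ 4 := by
        have : NNReal.pi ≤ 4 := by exact_mod_cast Real.pi_le_four
        exact_mod_cast this
      calc _ ≤ 400 * (ENNReal.ofReal (r x) ^ 2 * 4) := by gcongr
        _ = (400 * 4) * ENNReal.ofReal (r x) ^ 2 := by ring
        _ = _ := by norm_num
    have hr20 : ENNReal.ofReal (r x ^ 2) ≠ 0 := by simpa using hrx.ne'
    -- The disc of radius `20r` has area `400πr² ≤ 1600r²`. Hence the uniform term is at most `1600
    -- l`, that is, at most `G y / 2` wherever `G y > 3200 l`, and it is absorbed in `hpt`.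
    have hAB : (ENNReal.ofReal (r x ^ 2))⁻¹ * (A + B) ≤ 1600 * l := by
      rw [mul_comm, ← div_eq_mul_inv]
      refine ENNReal.div_le_of_le_mul ?_
      calc A + B ≤ A + M * B := by
            gcongr
            exact le_mul_of_one_le_left zero_le (by exact_mod_cast hM)
        _ ≤ l * (1600 * ENNReal.ofReal (r x ^ 2)) := h2.trans (by gcongr)
        _ = _ := by ring
    have hpt : ∀ y ∈ closedBall x (5 * r x) ∩ E', (G y : ℝ≥0∞) ≤ 4 * P y := by
      rintro y ⟨hy, hyE⟩
      have h3 : (G y : ℝ≥0∞) ≤ 2 * P y + (G y : ℝ≥0∞) / 2 := by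
        refine (hGP y hy).trans ?_
        gcongr
        refine hAB.trans ?_
        rw [ENNReal.le_div_iff_mul_le (by norm_num) (by norm_num)]
        have : 3200 * l ≤ G y := le_of_lt hyE
        calc (1600 : ℝ≥0∞) * l * 2 = ((3200 * l : ℝ≥0) : ℝ≥0∞) := by push_cast; ring
          _ ≤ _ := by exact_mod_cast this
      have hfin : (G y : ℝ≥0∞) / 2 ≠ ⊤ := ENNReal.div_ne_top ENNReal.coe_ne_top (by norm_num)
      have h4 : (G y : ℝ≥0∞) / 2 ≤ 2 * P y := by
        rw [← ENNReal.add_le_add_iff_right hfin, ENNReal.add_halves]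
        exact h3
      calc (G y : ℝ≥0∞) = 2 * ((G y : ℝ≥0∞) / 2) := by
            rw [ENNReal.mul_div_cancel (by norm_num) (by norm_num)]
        _ ≤ 2 * (2 * P y) := by gcongr
        _ = (2 * 2) * P y := by ring
        _ = _ := by norm_num
    calc M * ∫⁻ y in closedBall x (5 * r x) ∩ E', (G y : ℝ≥0∞) ≤ M * ∫⁻ y, 4 * P y := by
          exact mul_le_mul_right ((setLIntegral_mono' (measurableSet_closedBall.inter hE')
            hpt).trans (setLIntegral_le_lintegral _ _)) _
      _ ≤ M * (4 * B) := by
          rw [lintegral_const_mul _ hPm]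
          gcongr
      _ ≤ 4 * (A + M * B) := by
          calc (M : ℝ≥0∞) * (4 * B) = 4 * (M * B) := by ring
            _ ≤ _ := by gcongr; exact le_add_self
      _ ≤ 4 * (l * (400 * volume (closedBall x (r x)))) := by
          rw [← hv]; gcongr
      _ = (4 * 400) * (l * volume (closedBall x (r x))) := by ring
      _ = _ := by norm_num
  have : Countable u := hu.to_subtype
  have hsum : ∀ (f : ℂ → ℝ≥0) (S : Set ℂ), MeasurableSet S →
      ∑' x : u, ∫⁻ y in closedBall (x : ℂ) (r x) ∩ S, f y ≤ ∫⁻ y in S, f y := by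
    intro f S hS
    rw [← lintegral_iUnion (fun x => measurableSet_closedBall.inter hS)]
    · exact lintegral_mono_set (iUnion_subset fun x => inter_subset_right)
    · intro x y hxy
      exact (hdisj x.2 y.2 (fun h => hxy (Subtype.ext h))).mono inter_subset_left inter_subset_left
  have hsub : E' ⊆ ⋃ x : u, closedBall (x : ℂ) (5 * r x) ∩ E' := by
    intro y hy
    have hyE : y ∈ E := by
      refine lt_of_le_of_lt ?_ (show 3200 * l < G y from hy)
      exact le_mul_of_one_le_left zero_le (by norm_num)
    obtain ⟨b, hb, hsubb⟩ := hcov y hyE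
    exact mem_iUnion.2 ⟨⟨b, hb⟩, hsubb (mem_closedBall_self (hr0 y hyE).le), hy⟩
  calc M * ∫⁻ y in E', (G y : ℝ≥0∞)
      ≤ M * ∑' x : u, ∫⁻ y in closedBall (x : ℂ) (5 * r x) ∩ E', (G y : ℝ≥0∞) := by
        gcongr
        exact (lintegral_mono_set hsub).trans (lintegral_iUnion_le _ _)
    _ = ∑' x : u, M * ∫⁻ y in closedBall (x : ℂ) (5 * r x) ∩ E', (G y : ℝ≥0∞) := by
        rw [ENNReal.tsum_mul_left]
    _ ≤ ∑' x : u, 3200 * ((∫⁻ y in closedBall (x : ℂ) (r x) ∩ S₁, (G y : ℝ≥0∞)) +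
          M * ∫⁻ y in closedBall (x : ℂ) (r x) ∩ S₂, (H y : ℝ≥0∞)) := by
        -- The constant `3200` is `1600` from `hout` times `2` from `hin`.
        refine ENNReal.tsum_le_tsum fun x => (hout x x.2).trans ?_
        refine (mul_le_mul_right (hin x x.2) _).trans (le_of_eq ?_)
        rw [← mul_assoc]
        norm_num
    _ = 3200 * ((∑' x : u, ∫⁻ y in closedBall (x : ℂ) (r x) ∩ S₁, (G y : ℝ≥0∞)) +
          M * ∑' x : u, ∫⁻ y in closedBall (x : ℂ) (r x) ∩ S₂, (H y : ℝ≥0∞)) := by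
        rw [ENNReal.tsum_mul_left, ENNReal.tsum_add, ENNReal.tsum_mul_left]
    _ ≤ _ := by
        gcongr
        · exact hsum G S₁ hS₁
        · exact hsum H S₂ hS₂

end LevelSets

/-! ### From level sets to `L^p` bounds. -/

section LayerCake

lemma lintegral_Ioo_rpow {s : ℝ} (hs : 0 < s) {a : ℝ} (ha : 0 ≤ a) :
    ∫⁻ t in Ioo 0 a, ENNReal.ofReal (t ^ (s - 1)) = ENNReal.ofReal (a ^ s / s) := by
  rw [← ofReal_integral_eq_lintegral_ofReal]
  · rw [← integral_Ioc_eq_integral_Ioo, ← intervalIntegral.integral_of_le ha,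
      integral_rpow (.inl (by linarith))]
    simp [Real.zero_rpow hs.ne']
  · have := intervalIntegral.intervalIntegrable_rpow' (a := 0) (b := a) (r := s - 1) (by linarith)
    rw [intervalIntegrable_iff_integrableOn_Ioo_of_le ha] at this
    exact this
  · filter_upwards [ae_restrict_mem measurableSet_Ioo] with t ht
    exact Real.rpow_nonneg ht.1.le _

/-- By Tonelli: for fixed `y` the level condition reads `t < f y / c`, and the integral of `t^(s-1)`
up to there is `(f y / c)^s / s`. -/
lemma lintegral_rpow_mul_superlevel {s : ℝ} (hs : 0 < s) {c : ℝ} (hc : 0 < c) {f : ℂ → ℝ≥0}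
    (hf : Measurable f) :
    ∫⁻ t in Ioi (0 : ℝ), ENNReal.ofReal (t ^ (s - 1)) *
        ∫⁻ y in {y | c.toNNReal * t.toNNReal < f y}, f y =
      ENNReal.ofReal ((c ^ s)⁻¹ / s) * ∫⁻ y, (f y : ℝ≥0∞) ^ (1 + s) := by
  have hm : ∀ t : ℝ, MeasurableSet {y | c.toNNReal * t.toNNReal < f y} := fun t =>
    measurableSet_lt measurable_const hf
  have hm2 : MeasurableSet {p : ℝ × ℂ | c.toNNReal * p.1.toNNReal < f p.2} :=
    measurableSet_lt (by fun_prop) (by fun_prop)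
  calc _ = ∫⁻ t in Ioi (0 : ℝ), ∫⁻ y, {p : ℝ × ℂ | c.toNNReal * p.1.toNNReal < f p.2}.indicator
          (fun p => ENNReal.ofReal (p.1 ^ (s - 1)) * f p.2) (t, y) := by
        refine lintegral_congr fun t => ?_
        rw [← lintegral_const_mul _ (by fun_prop), ← lintegral_indicator (hm t)]
        rfl
    _ = ∫⁻ y, ∫⁻ t in Ioi (0 : ℝ), {p : ℝ × ℂ | c.toNNReal * p.1.toNNReal < f p.2}.indicator
          (fun p => ENNReal.ofReal (p.1 ^ (s - 1)) * f p.2) (t, y) := by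
        rw [lintegral_lintegral_swap]
        exact (Measurable.indicator (by fun_prop) hm2).aemeasurable
    _ = ∫⁻ y, f y * ∫⁻ t in Ioo 0 (f y / c : ℝ), ENNReal.ofReal (t ^ (s - 1)) := by
        refine lintegral_congr fun y => ?_
        rw [← lintegral_const_mul _ (by fun_prop), ← lintegral_indicator measurableSet_Ioi,
          ← lintegral_indicator measurableSet_Ioo]
        refine lintegral_congr fun t => ?_
        by_cases ht : 0 < t
        · have h1 : c.toNNReal * t.toNNReal < f y ↔ t < f y / c := by
            rw [lt_div_iff₀ hc, ← NNReal.coe_lt_coe, NNReal.coe_mul, Real.coe_toNNReal _ hc.le,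
              Real.coe_toNNReal _ ht.le, mul_comm]
          by_cases h : t < f y / c
          · simp [indicator, ht, h, h1, mul_comm]
          · simp [indicator, ht, h, h1]
        · simp [indicator, ht]
    _ = ∫⁻ y, ENNReal.ofReal ((c ^ s)⁻¹ / s) * (f y : ℝ≥0∞) ^ (1 + s) := by
        refine lintegral_congr fun y => ?_
        rw [lintegral_Ioo_rpow hs (by positivity), ENNReal.rpow_add_of_nonneg _ _ zero_le_one hs.le,
          ENNReal.rpow_one, Real.div_rpow (by positivity) hc.le,
          show (f y : ℝ) ^ s / c ^ s / s = (c ^ s)⁻¹ / s * (f y : ℝ) ^ s by ring,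
          ENNReal.ofReal_mul (by positivity), ← ENNReal.ofReal_rpow_of_nonneg (by positivity) hs.le,
          ENNReal.ofReal_coe_nnreal]
        ring
    _ = _ := by
        rw [lintegral_const_mul _ (by fun_prop)]

end LayerCake

/-- A local decomposition at all scales implies an `L^{1+s}` bound. -/
lemma exists_lintegral_rpow_le {s : ℝ} (hs : 0 < s) : ∃ C : ℝ≥0, ∀ G H : ℂ → ℝ≥0,
    Continuous G → Continuous H → ∫⁻ y, G y ≠ ⊤ → ∫⁻ y, H y ≠ ⊤ →
    ∫⁻ y, (G y : ℝ≥0∞) ^ (1 + s) ≠ ⊤ →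
    (∀ x : ℂ, ∀ r : ℝ, 0 < r → ∃ P : ℂ → ℝ≥0∞, Measurable P ∧
      ∫⁻ y, P y ≤ ∫⁻ y in closedBall x (20 * r), H y ∧
      ∀ y ∈ closedBall x (5 * r), G y ≤ 2 * P y + (ENNReal.ofReal (r ^ 2))⁻¹ *
        ((∫⁻ y in closedBall x (20 * r), G y) + ∫⁻ y in closedBall x (20 * r), H y)) →
    ∫⁻ y, (G y : ℝ≥0∞) ^ (1 + s) ≤ C * ∫⁻ y, (H y : ℝ≥0∞) ^ (1 + s) := by
  -- Integrating the level set inequality against `t^(s-1)` puts `M · 3200^(-s) X` against `3200 ·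
  -- 4^s X`. Since `12800 = 3200 · 4`, the choice `M = 6400 k` makes the right-hand term half of the
  -- left one; it can be subtracted because `X` is finite.
  set k : ℝ := 12800 ^ s
  have hk : 1 ≤ k := Real.one_le_rpow (by norm_num) hs.le
  set M : ℝ := 6400 * k
  have hM : 1 ≤ M := by simp only [M]; linarith
  refine ⟨(6400 * (12800 * M) ^ s).toNNReal, fun G H hG hH hGi hHi hX hloc => ?_⟩
  set X := ∫⁻ y, (G y : ℝ≥0∞) ^ (1 + s)
  set Y := ∫⁻ y, (H y : ℝ≥0∞) ^ (1 + s)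
  have hmeas : ∀ (c : ℝ) (f : ℂ → ℝ≥0), Measurable f → Measurable fun t : ℝ =>
      ∫⁻ y in {y | c.toNNReal * t.toNNReal < f y}, (f y : ℝ≥0∞) := by
    intro c f hf
    have hm2 : MeasurableSet {p : ℝ × ℂ | c.toNNReal * p.1.toNNReal < f p.2} :=
      measurableSet_lt (by fun_prop) (by fun_prop)
    have : Measurable fun t : ℝ => ∫⁻ y, {p : ℝ × ℂ | c.toNNReal * p.1.toNNReal < f p.2}.indicator
        (fun p => (f p.2 : ℝ≥0∞)) (t, y) :=
      (Measurable.indicator (by fun_prop) hm2).lintegral_prod_right'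
    convert this using 2 with t
    rw [← lintegral_indicator (measurableSet_lt measurable_const hf)]
    rfl
  have h1 : ∀ t ∈ Ioi (0 : ℝ), ENNReal.ofReal (t ^ (s - 1)) * (ENNReal.ofReal M *
      ∫⁻ y in {y | (3200 : ℝ).toNNReal * t.toNNReal < G y}, G y) ≤
      ENNReal.ofReal (t ^ (s - 1)) * (3200 * ((∫⁻ y in {y | (1 / 4 : ℝ).toNNReal * t.toNNReal < G y},
        G y) + ENNReal.ofReal M *
          ∫⁻ y in {y | (1 / (4 * M)).toNNReal * t.toNNReal < H y}, H y)) := by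
    intro t ht
    refine mul_le_mul_right ?_ _
    have := lintegral_superlevel_le hG hH hGi hHi hloc (M := M.toNNReal) (l := t.toNNReal)
      (by simpa using hM) (by simpa using ht)
    have e1 : (3200 : ℝ).toNNReal = 3200 := by simp
    have e2 : (1 / 4 : ℝ).toNNReal * t.toNNReal = t.toNNReal / 4 := by
      rw [Real.toNNReal_div (by norm_num)]; simp; ring
    have e3 : (1 / (4 * M) : ℝ).toNNReal * t.toNNReal = t.toNNReal / (4 * M.toNNReal) := by
      rw [Real.toNNReal_div (by norm_num), Real.toNNReal_mul (by norm_num)]; simp; ring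
    rw [e1, e2, e3]
    exact this
  have h2 := setLIntegral_mono' (μ := volume) measurableSet_Ioi h1
  have hr : Measurable fun t : ℝ => ENNReal.ofReal (t ^ (s - 1)) := by fun_prop
  have hm1 := hmeas 3200 G hG.measurable
  have hm2 := hmeas (1 / 4) G hG.measurable
  have hm3 := hmeas (1 / (4 * M)) H hH.measurable
  simp only [mul_add, mul_left_comm (ENNReal.ofReal (_ ^ (s - 1)))] at h2
  rw [lintegral_add_left (by fun_prop), lintegral_const_mul _ (by fun_prop),
    lintegral_const_mul _ (by fun_prop), lintegral_const_mul _ (by fun_prop),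
    lintegral_const_mul _ (by fun_prop),
    lintegral_rpow_mul_superlevel hs (by norm_num) hG.measurable,
    lintegral_rpow_mul_superlevel hs (by norm_num) hG.measurable,
    lintegral_rpow_mul_superlevel hs (by positivity) hH.measurable] at h2
  rcases eq_or_ne Y ⊤ with hY | hY
  · rw [hY, ENNReal.mul_top]
    · exact le_top
    · have : 0 < 6400 * (12800 * M) ^ s := by positivity
      simpa using this
  have h3 : M * ((3200 ^ s)⁻¹ / s * X.toReal) ≤ 3200 * (((1 / 4) ^ s)⁻¹ / s * X.toReal) +
      3200 * (M * (((1 / (4 * M)) ^ s)⁻¹ / s * Y.toReal)) := by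
    change _ * (_ * X) ≤ _ * (_ * X) + _ * (_ * (_ * Y)) at h2
    rw [← ENNReal.ofReal_toReal hX, ← ENNReal.ofReal_toReal hY, ← ENNReal.ofReal_ofNat 3200,
      ← ENNReal.ofReal_mul (by positivity), ← ENNReal.ofReal_mul (by positivity),
      ← ENNReal.ofReal_mul (by positivity), ← ENNReal.ofReal_mul (by positivity),
      ← ENNReal.ofReal_mul (by positivity), ← ENNReal.ofReal_mul (by positivity),
      ← ENNReal.ofReal_mul (by positivity), ← ENNReal.ofReal_add (by positivity) (by positivity),
      ENNReal.ofReal_le_ofReal_iff (by positivity)] at h2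
    exact h2
  have h4 : X.toReal ≤ 6400 * (12800 * M) ^ s * Y.toReal := by
    rw [Real.div_rpow (by norm_num) (by norm_num), Real.one_rpow,
      Real.div_rpow (by norm_num) (by positivity), Real.one_rpow, one_div, inv_inv, one_div,
      inv_inv] at h3
    have e1 : k = 3200 ^ s * 4 ^ s := by
      rw [← Real.mul_rpow (by norm_num) (by norm_num)]; norm_num [k]
    have e2 : (12800 * M) ^ s = 3200 ^ s * (4 * M) ^ s := by
      rw [← Real.mul_rpow (by norm_num) (by positivity)]; congr 1; ring
    have h5 := mul_le_mul_of_nonneg_left h3 (by positivity : 0 ≤ s * 3200 ^ s)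
    have h6 : M * X.toReal ≤ 3200 * k * X.toReal + 3200 * M * (12800 * M) ^ s * Y.toReal := by
      rw [e1, e2]
      have hp : (0 : ℝ) < 3200 ^ s := by positivity
      field_simp at h5 ⊢
      linarith
    have h7 : M * X.toReal ≤ M * (6400 * (12800 * M) ^ s * Y.toReal) := by
      have : 3200 * k * X.toReal = M * X.toReal / 2 := by simp only [M]; ring
      rw [this] at h6
      linarith
    exact le_of_mul_le_mul_left h7 (by linarith)
  rw [← ENNReal.ofReal_toReal hX, ← ENNReal.ofReal_toReal hY, ← ENNReal.ofReal,
    ← ENNReal.ofReal_mul (by positivity)]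
  exact ENNReal.ofReal_le_ofReal h4

/-- The Calderón–Zygmund estimate for the Beurling transform, for exponents `p ≥ 2`. -/
theorem exists_lintegral_enorm_beurling_rpow_le {p : ℝ} (hp : 2 ≤ p) :
    ∃ C : ℝ≥0, ∀ g : ℂ → ℂ, ContDiff ℝ ∞ g → HasCompactSupport g →
      ∫⁻ z, ‖beurling g z‖ₑ ^ p ≤ C * ∫⁻ z, ‖g z‖ₑ ^ p := by
  rcases hp.eq_or_lt with rfl | hp
  · refine ⟨1, fun g hg hc => le_of_eq ?_⟩
    simpa using lintegral_enorm_beurling_sq hg hc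
  -- The estimate is for squares: `|z|^p = (|z|²)^(1+s)`.
  set s := p / 2 - 1
  have hs : 0 < s := by simp only [s]; linarith
  have hps : p = 2 * (1 + s) := by simp only [s]; ring
  obtain ⟨C, hC⟩ := exists_lintegral_rpow_le hs
  refine ⟨C, fun g hg hc => ?_⟩
  have hpow : ∀ z : ℂ, ‖z‖ₑ ^ p = ((‖z‖₊ ^ 2 : ℝ≥0) : ℝ≥0∞) ^ (1 + s) := by
    intro z
    rw [hps, ENNReal.rpow_mul, ENNReal.coe_pow]
    simp [enorm_eq_nnnorm]
  have hsq : ∀ z : ℂ, ((‖z‖₊ ^ 2 : ℝ≥0) : ℝ≥0∞) = ‖z‖ₑ ^ 2 := by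
    intro z; simp [enorm_eq_nnnorm]
  have hgi : ∫⁻ z, ‖g z‖ₑ ^ 2 ≠ ⊤ := by
    have h := (hg.continuous.memLp_of_hasCompactSupport (p := 2) (μ := volume) hc).eLpNorm_lt_top
    have := lintegral_rpow_enorm_lt_top_of_eLpNorm_lt_top (by norm_num) (by norm_num) h
    simpa using this.ne
  simp only [hpow]
  refine hC (fun z => ‖beurling g z‖₊ ^ 2) (fun z => ‖g z‖₊ ^ 2)
    ((contDiff_beurling hg hc).continuous.nnnorm.pow 2) (hg.continuous.nnnorm.pow 2) ?_ ?_ ?_ ?_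
  · simp only [hsq]
    rwa [lintegral_enorm_beurling_sq hg hc]
  · simpa only [hsq] using hgi
  -- A priori finiteness, required for the absorption: `beurling g` is bounded and square
  -- integrable, and `p > 2`.
  · obtain ⟨A, hA0, hA⟩ := exists_decay_beurling hg hc
    have hb : ∀ z, ‖beurling g z‖ₑ ≤ ENNReal.ofReal A := by
      intro z
      rw [← ofReal_norm]
      refine ENNReal.ofReal_le_ofReal ((hA z).trans (mul_le_of_le_one_right hA0 ?_))
      exact pow_le_one₀ (by positivity) (inv_le_one_of_one_le₀ (by linarith [norm_nonneg z]))
    refine ne_top_of_le_ne_top (b := (ENNReal.ofReal A ^ 2) ^ s * ∫⁻ z, ‖beurling g z‖ₑ ^ 2) ?_ ?_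
    · rw [lintegral_enorm_beurling_sq hg hc]
      exact ENNReal.mul_ne_top (ENNReal.rpow_ne_top_of_nonneg hs.le (by simp)) hgi
    · have hm : Measurable fun z => ‖beurling g z‖ₑ ^ 2 :=
        (contDiff_beurling hg hc).continuous.measurable.enorm.pow_const 2
      rw [← lintegral_const_mul _ hm]
      refine lintegral_mono fun z => ?_
      rw [hsq, ENNReal.rpow_add_of_nonneg _ _ zero_le_one hs.le, ENNReal.rpow_one, mul_comm]
      gcongr
      exact hb z
  · intro x r hr
    simpa only [hsq] using exists_local_decomposition hg hc x hr

/-! ### Hardy inequality from rotational equivariance. -/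

section Hardy

lemma lintegral_rpow_le_of_measure {α : Type*} [MeasurableSpace α] {μ : Measure α} {p : ℝ}
    (hp : 1 < p) {f : α → ℝ≥0∞} (hf : AEMeasurable f μ) :
    (∫⁻ x, f x ∂μ) ^ p ≤ μ univ ^ (p - 1) * ∫⁻ x, f x ^ p ∂μ := by
  have hpq := Real.HolderConjugate.conjExponent hp
  have h := ENNReal.lintegral_mul_le_Lp_mul_Lq μ hpq hf (aemeasurable_const (b := (1 : ℝ≥0∞)))
  simp only [Pi.mul_apply, mul_one, ENNReal.one_rpow, lintegral_const, one_mul] at h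
  have hp0 : 0 < p := by linarith
  calc (∫⁻ x, f x ∂μ) ^ p ≤
        ((∫⁻ x, f x ^ p ∂μ) ^ (1 / p) * μ univ ^ (1 / p.conjExponent)) ^ p :=
        ENNReal.rpow_le_rpow h hp0.le
    _ = _ := by
        rw [ENNReal.mul_rpow_of_nonneg _ _ hp0.le, ← ENNReal.rpow_mul, ← ENNReal.rpow_mul,
          one_div_mul_cancel hp0.ne', ENNReal.rpow_one, mul_comm]
        congr 2
        rw [Real.conjExponent]
        have : p - 1 ≠ 0 := by linarith
        field_simp

lemma lintegral_comp_exp_mul (θ : ℝ) (f : ℂ → ℝ≥0∞) :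
    ∫⁻ z, f (Complex.exp (θ * Complex.I) * z) = ∫⁻ z, f z := by
  have := (rotation (Circle.exp θ)).measurePreserving.lintegral_comp_emb
    (rotation (Circle.exp θ)).toHomeomorph.measurableEmbedding f
  simpa [rotation_apply, Circle.coe_exp] using this

lemma integral_comp_exp_mul (θ : ℝ) (f : ℂ → ℂ) :
    ∫ z, f (Complex.exp (θ * Complex.I) * z) = ∫ z, f z := by
  have := (rotation (Circle.exp θ)).measurePreserving.integral_comp
    (rotation (Circle.exp θ)).toHomeomorph.measurableEmbedding f
  simpa [rotation_apply, Circle.coe_exp] using this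

/-- A Hardy inequality for rotationally equivariant functions. -/
lemma lintegral_hardy_le {u : ℂ → ℂ} (hu : ContDiff ℝ ∞ u) {θ₀ : ℝ} (hθ : 0 ≤ θ₀) {c : ℂ}
    (hc : c ≠ 1) (hsym : ∀ z, u (Complex.exp (θ₀ * Complex.I) * z) = c * u z) {p : ℝ}
    (hp : 1 < p) :
    ∫⁻ z, ‖(‖z‖⁻¹ : ℝ) • u z‖ₑ ^ p ≤
      (‖(c - 1)⁻¹‖ₑ * ENNReal.ofReal θ₀) ^ p * ∫⁻ z, ‖fderiv ℝ u z‖ₑ ^ p := by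
  have hp0 : 0 < p := by linarith
  let e : ℝ → ℂ := fun θ => Complex.exp (θ * Complex.I)
  have hnorm : ∀ θ, ‖e θ‖ = 1 := fun θ => Complex.norm_exp_ofReal_mul_I θ
  have hcont : Continuous (fderiv ℝ u) := hu.continuous_fderiv (by simp)
  have hder : ∀ (z : ℂ) (θ : ℝ),
      HasDerivAt (fun θ : ℝ => u (e θ * z)) (fderiv ℝ u (e θ * z) (e θ * Complex.I * z)) θ := by
    intro z θ
    have h0 : HasDerivAt e (e θ * Complex.I) θ := by
      simpa using ((Complex.ofRealCLM.hasDerivAt (x := θ)).mul_const Complex.I).cexp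
    exact (hu.differentiable (by simp) (e θ * z)).hasFDerivAt.comp_hasDerivAt θ (h0.mul_const z)
  -- Equivariance gives `(c - 1) u z = u (e^{iθ₀} z) - u z`, the integral of the angular derivative
  -- over the arc; that derivative is at most `|z|` times `‖Du‖`.
  have hpt : ∀ z : ℂ, ‖(‖z‖⁻¹ : ℝ) • u z‖ₑ ≤
      ‖(c - 1)⁻¹‖ₑ * ∫⁻ θ in Ioc 0 θ₀, ‖fderiv ℝ u (e θ * z)‖ₑ := by
    intro z
    rcases eq_or_ne z 0 with rfl | hz
    · simp
    have h1 : (c - 1) * u z = ∫ θ in Ioc 0 θ₀, fderiv ℝ u (e θ * z) (e θ * Complex.I * z) := by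
      rw [← intervalIntegral.integral_of_le hθ,
        intervalIntegral.integral_eq_sub_of_hasDerivAt (fun θ _ => hder z θ)]
      · have := hsym z
        simp only [e, this]
        simp [sub_mul]
      · exact Continuous.intervalIntegrable (by fun_prop) _ _
    have h2 : u z = (c - 1)⁻¹ * ((c - 1) * u z) := by
      rw [inv_mul_cancel_left₀ (sub_ne_zero.2 hc)]
    have h3 : ‖(c - 1) * u z‖ₑ ≤ ‖z‖ₑ * ∫⁻ θ in Ioc 0 θ₀, ‖fderiv ℝ u (e θ * z)‖ₑ := by
      rw [h1, ← lintegral_const_mul _ (by fun_prop)]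
      refine (enorm_integral_le_lintegral_enorm _).trans (lintegral_mono fun θ => ?_)
      refine (ContinuousLinearMap.le_opENorm _ _).trans (le_of_eq ?_)
      rw [mul_comm]
      congr 1
      rw [enorm_eq_iff_norm_eq]
      simp [hnorm]
    have hz' : ‖z‖ₑ ≠ 0 := by simpa using hz
    have h4 : ‖(‖z‖⁻¹ : ℝ)‖ₑ = ‖z‖ₑ⁻¹ := by
      rw [enorm_inv (by simpa using hz), enorm_norm]
    rw [enorm_smul, h4, h2, enorm_mul, mul_left_comm]
    refine mul_le_mul_right ?_ _
    calc ‖z‖ₑ⁻¹ * ‖(c - 1) * u z‖ₑ ≤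
        ‖z‖ₑ⁻¹ * (‖z‖ₑ * ∫⁻ θ in Ioc 0 θ₀, ‖fderiv ℝ u (e θ * z)‖ₑ) := by gcongr
      _ = _ := by rw [← mul_assoc, ENNReal.inv_mul_cancel hz' (by simp), one_mul]
  calc ∫⁻ z, ‖(‖z‖⁻¹ : ℝ) • u z‖ₑ ^ p
      ≤ ∫⁻ z, ‖(c - 1)⁻¹‖ₑ ^ p * (ENNReal.ofReal θ₀ ^ (p - 1) *
          ∫⁻ θ in Ioc 0 θ₀, ‖fderiv ℝ u (e θ * z)‖ₑ ^ p) := by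
        refine lintegral_mono fun z => ?_
        refine (ENNReal.rpow_le_rpow (hpt z) hp0.le).trans ?_
        rw [ENNReal.mul_rpow_of_nonneg _ _ hp0.le]
        refine mul_le_mul_right ?_ _
        refine (lintegral_rpow_le_of_measure hp (by fun_prop)).trans (le_of_eq ?_)
        simp
    _ = ‖(c - 1)⁻¹‖ₑ ^ p * (ENNReal.ofReal θ₀ ^ (p - 1) *
          ∫⁻ z, ∫⁻ θ in Ioc 0 θ₀, ‖fderiv ℝ u (e θ * z)‖ₑ ^ p) := by
        rw [lintegral_const_mul', lintegral_const_mul']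
        · exact ENNReal.rpow_ne_top_of_nonneg (by linarith) ENNReal.ofReal_ne_top
        · exact ENNReal.rpow_ne_top_of_nonneg hp0.le enorm_ne_top
    -- After Tonelli, rotation invariance of area makes the inner integral independent of `θ`.
    _ = ‖(c - 1)⁻¹‖ₑ ^ p * (ENNReal.ofReal θ₀ ^ (p - 1) *
          ∫⁻ θ in Ioc 0 θ₀, ∫⁻ z, ‖fderiv ℝ u z‖ₑ ^ p) := by
        rw [lintegral_lintegral_swap]
        · congr 3 with θ
          exact lintegral_comp_exp_mul θ fun z => ‖fderiv ℝ u z‖ₑ ^ p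
        · have : Measurable fun q : ℂ × ℝ => ‖fderiv ℝ u (e q.2 * q.1)‖ₑ ^ p := by
            have : Continuous fun q : ℂ × ℝ => fderiv ℝ u (e q.2 * q.1) := by fun_prop
            exact this.measurable.enorm.pow_const p
          exact this.aemeasurable
    _ = _ := by
        rw [setLIntegral_const, Real.volume_Ioc, sub_zero, ENNReal.mul_rpow_of_nonneg _ _ hp0.le]
        have : ENNReal.ofReal θ₀ ^ p = ENNReal.ofReal θ₀ ^ (p - 1) * ENNReal.ofReal θ₀ := by
          conv_lhs => rw [show p = (p - 1) + 1 by ring]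
          rw [ENNReal.rpow_add_of_nonneg _ _ (by linarith) zero_le_one, ENNReal.rpow_one]
        rw [this]
        ring

end Hardy

/-! ### `L^q` estimates for the Cauchy transform of symmetric functions. -/

section Symmetric

variable {g : ℂ → ℂ}

/-- Rotating both variables multiplies the kernel `1/(z - w)` by `e^{-iθ}` and preserves area. -/
lemma cauchyInt_exp_mul {θ : ℝ} (h : ∀ z, g (Complex.exp (θ * Complex.I) * z) = g z) (z : ℂ) :
    cauchyInt g (Complex.exp (θ * Complex.I) * z) =
      (Complex.exp (θ * Complex.I))⁻¹ * cauchyInt g z := by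
  rw [cauchyInt_eq, cauchyInt_eq, ← integral_comp_exp_mul θ, ← integral_const_mul]
  congr with w
  rw [h, ← mul_sub, mul_inv, mul_assoc]

/-- The real differential is `w ↦ ∂u · w + ∂̄u · conj w`. -/
lemma norm_fderiv_le_wirt (u : ℂ → ℂ) (z : ℂ) :
    ‖fderiv ℝ u z‖ ≤ ‖wirt u z‖ + ‖wirtBar u z‖ := by
  refine ContinuousLinearMap.opNorm_le_bound _ (by positivity) fun w => ?_
  have hconj : (starRingEnd ℂ) w = w.re - w.im * Complex.I := by apply Complex.ext <;> simp
  have : fderiv ℝ u z w = wirt u z * w + wirtBar u z * (starRingEnd ℂ) w := by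
    conv_lhs => rw [show w = w.re • (1 : ℂ) + w.im • Complex.I by simp [Complex.re_add_im]]
    rw [map_add, map_smul, map_smul, Complex.real_smul, Complex.real_smul, wirt, wirtBar,
      hconj]
    nth_rewrite 3 [← Complex.re_add_im w]
    linear_combination (w.im * fderiv ℝ u z Complex.I) * Complex.I_sq
  rw [this, add_mul]
  refine (norm_add_le _ _).trans ?_
  rw [norm_mul, norm_mul, RCLike.norm_conj]

lemma norm_fderiv_cauchyInt_le (hg : ContDiff ℝ ∞ g) (hc : HasCompactSupport g) (z : ℂ) :
    ‖fderiv ℝ (cauchyInt g) z‖ ≤ NNReal.pi * ‖‖beurling g z‖ + ‖g z‖‖ := by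
  refine (norm_fderiv_le_wirt _ _).trans (le_of_eq ?_)
  have hpi := Real.pi_pos
  have h : wirt (cauchyInt g) z = Real.pi * beurling g z := by
    rw [beurling, mul_inv_cancel_left₀ (by simp [hpi.ne'])]
  rw [wirtBar_cauchyInt hg hc, h, norm_mul, norm_mul, Complex.norm_real,
    Real.norm_of_nonneg hpi.le, Real.norm_of_nonneg (by positivity), ← mul_add]
  rfl

variable {q : ℝ≥0∞}

theorem exists_eLpNorm_beurling_le (hq : 2 ≤ q) (hq' : q < ⊤) :
    ∃ C : ℝ≥0, ∀ g : ℂ → ℂ, ContDiff ℝ ∞ g → HasCompactSupport g →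
      eLpNorm (beurling g) q volume ≤ C * eLpNorm g q volume := by
  have hp : 2 ≤ q.toReal := by simpa using ENNReal.toReal_mono hq'.ne hq
  have hq0 : q ≠ 0 := (zero_lt_two.trans_le hq).ne'
  obtain ⟨C, hC⟩ := exists_lintegral_enorm_beurling_rpow_le hp
  refine ⟨C ^ (1 / q.toReal), fun g hg hc => ?_⟩
  rw [eLpNorm_eq_lintegral_rpow_enorm_toReal hq0 hq'.ne,
    eLpNorm_eq_lintegral_rpow_enorm_toReal hq0 hq'.ne, ENNReal.coe_rpow_of_nonneg _ (by positivity),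
    ← ENNReal.mul_rpow_of_nonneg _ _ (by positivity)]
  exact ENNReal.rpow_le_rpow (hC g hg hc) (by positivity)

theorem exists_eLpNorm_fderiv_cauchyInt_le (hq : 2 ≤ q) (hq' : q < ⊤) :
    ∃ C : ℝ≥0, ∀ g : ℂ → ℂ, ContDiff ℝ ∞ g → HasCompactSupport g →
      eLpNorm (fderiv ℝ (cauchyInt g)) q volume ≤ C * eLpNorm g q volume := by
  obtain ⟨C, hC⟩ := exists_eLpNorm_beurling_le hq hq'
  refine ⟨NNReal.pi * (C + 1), fun g hg hc => ?_⟩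
  calc eLpNorm (fderiv ℝ (cauchyInt g)) q volume
      ≤ NNReal.pi • eLpNorm (fun z => ‖beurling g z‖ + ‖g z‖) q volume := by
        refine eLpNorm_le_nnreal_smul_eLpNorm_of_ae_le_mul (.of_forall fun z => ?_) _
        rw [← NNReal.coe_le_coe]
        exact norm_fderiv_cauchyInt_le hg hc z
    _ ≤ NNReal.pi • (eLpNorm (beurling g) q volume + eLpNorm g q volume) := by
        gcongr
        refine (eLpNorm_add_le (contDiff_beurling hg hc).continuous.norm.aestronglyMeasurable
          hg.continuous.norm.aestronglyMeasurable (one_le_two.trans hq)).trans (le_of_eq ?_)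
        rw [eLpNorm_norm, eLpNorm_norm]
    _ ≤ NNReal.pi • (C * eLpNorm g q volume + eLpNorm g q volume) := by
        gcongr
        exact hC g hg hc
    _ = _ := by
        rw [ENNReal.smul_def, smul_eq_mul]
        push_cast
        ring

theorem exists_eLpNorm_cauchyInt_le {m : ℕ} (hm : 2 ≤ m) (hq : 2 ≤ q) (hq' : q < ⊤) :
    ∃ C : ℝ≥0, ∀ g : ℂ → ℂ, ContDiff ℝ ∞ g → HasCompactSupport g →
      (∀ z, g (Complex.exp ((2 * Real.pi / m : ℝ) * Complex.I) * z) = g z) →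
      eLpNorm (fun z => (‖z‖⁻¹ : ℝ) • cauchyInt g z) q volume ≤ C * eLpNorm g q volume ∧
      eLpNorm (fderiv ℝ (cauchyInt g)) q volume ≤ C * eLpNorm g q volume := by
  obtain ⟨C, hC⟩ := exists_eLpNorm_fderiv_cauchyInt_le hq hq'
  have hp : 2 ≤ q.toReal := by simpa using ENNReal.toReal_mono hq'.ne hq
  have hq0 : q ≠ 0 := (zero_lt_two.trans_le hq).ne'
  set θ₀ : ℝ := 2 * Real.pi / m
  set c : ℂ := (Complex.exp (θ₀ * Complex.I))⁻¹
  have hm0 : (2 : ℝ) ≤ m := by exact_mod_cast hm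
  -- Here `m ≥ 2` is essential: for `m = 1` the factor `c` is `1` and the Hardy inequality does not
  -- apply.
  have hc1 : c ≠ 1 := by
    simp only [c, ne_eq, inv_eq_one]
    have h := (Complex.isPrimitiveRoot_exp m (by omega)).ne_one (by omega)
    convert h using 2
    simp only [θ₀]
    push_cast
    ring_nf
  set D : ℝ≥0 := ‖(c - 1)⁻¹‖₊ * θ₀.toNNReal
  refine ⟨max (D * C) C, fun g hg hgc hs => ⟨?_, (hC g hg hgc).trans ?_⟩⟩
  · have h := lintegral_hardy_le (contDiff_cauchyInt hg hgc) (θ₀ := θ₀) (by positivity) hc1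
      (cauchyInt_exp_mul hs) (p := q.toReal) (by linarith)
    have h2 : eLpNorm (fun z => (‖z‖⁻¹ : ℝ) • cauchyInt g z) q volume ≤
        D * eLpNorm (fderiv ℝ (cauchyInt g)) q volume := by
      rw [eLpNorm_eq_lintegral_rpow_enorm_toReal hq0 hq'.ne,
        eLpNorm_eq_lintegral_rpow_enorm_toReal hq0 hq'.ne]
      refine (ENNReal.rpow_le_rpow h (by positivity)).trans (le_of_eq ?_)
      rw [ENNReal.mul_rpow_of_nonneg _ _ (by positivity), ← ENNReal.rpow_mul,
        mul_one_div_cancel (by linarith), ENNReal.rpow_one]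
      simp only [D, ENNReal.coe_mul]
      rfl
    calc _ ≤ _ := h2
      _ ≤ D * (C * eLpNorm g q volume) := by gcongr; exact hC g hg hgc
      _ = (D * C : ℝ≥0) * eLpNorm g q volume := by push_cast; ring
      _ ≤ _ := by gcongr; exact le_max_left _ _
  · gcongr
    exact le_max_right _ _

end Symmetric

/-! ### From the Cauchy transform to the Biot–Savart law. -/

section Transfer

/-- The isometry between the complex plane and the Euclidean plane. -/
def toPlane : ℂ ≃ₗᵢ[ℝ] Plane := Complex.orthonormalBasisOneI.repr

@[simp] lemma toPlane_apply_zero (z : ℂ) : toPlane z 0 = z.re := by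
  simp [toPlane, Complex.orthonormalBasisOneI_repr_apply]

@[simp] lemma toPlane_apply_one (z : ℂ) : toPlane z 1 = z.im := by
  simp [toPlane, Complex.orthonormalBasisOneI_repr_apply]

lemma toPlane_exp_mul (θ : ℝ) (z : ℂ) :
    toPlane (Complex.exp (θ * Complex.I) * z) = rot θ (toPlane z) := by
  ext i
  fin_cases i
  · simp [rot, Complex.exp_mul_I, Complex.cos_ofReal_re, Complex.sin_ofReal_re]
  · simp [rot, Complex.exp_mul_I, Complex.cos_ofReal_re, Complex.sin_ofReal_re]
    ring

/-- The convolution `K₂ * f` for an arbitrary function `f`. -/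
def velocityFun (f : Plane → ℂ) (x : Plane) : Vel :=
  WithLp.toLp 2 fun i => ∫ y, ((K₂ (x - y) i : ℝ) : ℂ) * f y

lemma velocity_eq (f : 𝓢(Plane, ℂ)) : velocity f = velocityFun f := rfl

/-- The coefficient vector of the Cauchy transform in the Biot–Savart law. -/
def coeffHol : Vel := !₂[(4 * Real.pi * Complex.I)⁻¹, (4 * Real.pi : ℂ)⁻¹]

/-- The coefficient vector of the conjugate Cauchy transform in the Biot–Savart law. -/
def coeffAnti : Vel := !₂[-(4 * Real.pi * Complex.I)⁻¹, (4 * Real.pi : ℂ)⁻¹]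

/-- As a complex number the kernel is `i / (2π conj w)`; its components are the real and imaginary
parts, hence combinations of `w⁻¹` and its conjugate. -/
lemma K₂_toPlane (w : ℂ) (i : Fin 2) : ((K₂ (toPlane w) i : ℝ) : ℂ) =
    w⁻¹ * coeffHol i + (starRingEnd ℂ) w⁻¹ * coeffAnti i := by
  have hn : ‖toPlane w‖ ^ 2 = Complex.normSq w := by
    rw [LinearIsometryEquiv.norm_map, Complex.normSq_eq_norm_sq]
  have hpi : (Real.pi : ℂ) ≠ 0 := by simp [Real.pi_ne_zero]
  have h1 : (w⁻¹ : ℂ) = (w.re - w.im * Complex.I) * ((Complex.normSq w)⁻¹ : ℝ) := by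
    rw [Complex.inv_def]
    congr 1
    apply Complex.ext <;> simp
  have h2 : (starRingEnd ℂ) (w⁻¹ : ℂ) = (w.re + w.im * Complex.I) * ((Complex.normSq w)⁻¹ : ℝ) := by
    rw [Complex.inv_def, map_mul, Complex.conj_conj, Complex.conj_ofReal, Complex.re_add_im]
  have k0 : K₂ (toPlane w) 0 = (2 * Real.pi * Complex.normSq w)⁻¹ * -w.im := by
    rw [K₂, hn]; simp
  have k1 : K₂ (toPlane w) 1 = (2 * Real.pi * Complex.normSq w)⁻¹ * w.re := by
    rw [K₂, hn]; simp
  have a0 : coeffHol 0 = (4 * Real.pi * Complex.I)⁻¹ := rfl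
  have a1 : coeffHol 1 = (4 * Real.pi : ℂ)⁻¹ := rfl
  have b0 : coeffAnti 0 = -(4 * Real.pi * Complex.I)⁻¹ := rfl
  have b1 : coeffAnti 1 = (4 * Real.pi : ℂ)⁻¹ := rfl
  have hI : (Complex.I)⁻¹ = -Complex.I := Complex.inv_I
  rw [h2, h1]
  fin_cases i
  · simp only [Fin.zero_eta, k0, a0, b0, mul_inv, hI]
    push_cast
    linear_combination (-((Complex.normSq w : ℂ))⁻¹ * w.im * (Real.pi : ℂ)⁻¹ / 2) * Complex.I_sq
  · simp only [Fin.mk_one, k1, a1, b1, mul_inv]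
    push_cast
    ring

variable {f : Plane → ℂ}

lemma hasCompactSupport_comp_toPlane (hc : HasCompactSupport f) :
    HasCompactSupport (f ∘ toPlane) :=
  hc.comp_homeomorph toPlane.toHomeomorph

lemma contDiff_comp_toPlane (hf : ContDiff ℝ ∞ f) : ContDiff ℝ ∞ (f ∘ toPlane) :=
  hf.comp toPlane.toContinuousLinearEquiv.contDiff

lemma contDiff_conj_comp {g : ℂ → ℂ} (hg : ContDiff ℝ ∞ g) :
    ContDiff ℝ ∞ (fun z => (starRingEnd ℂ) (g z)) :=
  Complex.conjCLE.contDiff.comp hg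

lemma hasCompactSupport_conj_comp {g : ℂ → ℂ} (hc : HasCompactSupport g) :
    HasCompactSupport (fun z => (starRingEnd ℂ) (g z)) :=
  hc.mono fun z hz hz' => hz (by simp [hz'])

/-- Since `f` is complex valued, convolution with the conjugate kernel is the conjugate of the
Cauchy transform of the conjugate of `f`. -/
lemma velocityFun_toPlane (hf : ContDiff ℝ ∞ f) (hc : HasCompactSupport f) (z : ℂ) :
    velocityFun f (toPlane z) = cauchyInt (f ∘ toPlane) z • coeffHol +
      (starRingEnd ℂ) (cauchyInt (fun w => (starRingEnd ℂ) (f (toPlane w))) z) • coeffAnti := by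
  have hint : ∀ {g : ℂ → ℂ}, Continuous g → HasCompactSupport g →
      Integrable fun w => (z - w)⁻¹ * g w := by
    intro g hg hgc
    simpa using (integrable_cauchyInt_integrand hg hgc z).comp_sub_left z
  have h1 := hint (contDiff_comp_toPlane hf).continuous (hasCompactSupport_comp_toPlane hc)
  have h2 := hint (contDiff_conj_comp (contDiff_comp_toPlane hf)).continuous
    (hasCompactSupport_conj_comp (hasCompactSupport_comp_toPlane hc))
  have h3 : Integrable fun w => (starRingEnd ℂ) (z - w)⁻¹ * f (toPlane w) := by
    have := Complex.conjCLE.toContinuousLinearMap.integrable_comp h2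
    refine this.congr (.of_forall fun w => ?_)
    simp
  have h4 : (starRingEnd ℂ) (cauchyInt (fun w => (starRingEnd ℂ) (f (toPlane w))) z) =
      ∫ w, (starRingEnd ℂ) (z - w)⁻¹ * f (toPlane w) := by
    rw [cauchyInt_eq, ← integral_conj]
    simp
  ext i
  have h5 : velocityFun f (toPlane z) i = ∫ w, ((K₂ (toPlane z - toPlane w) i : ℝ) : ℂ) *
      f (toPlane w) := by
    rw [velocityFun]
    exact (toPlane.measurePreserving.integral_comp toPlane.toHomeomorph.measurableEmbedding
      fun y => ((K₂ (toPlane z - y) i : ℝ) : ℂ) * f y).symm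
  rw [h5, h4, cauchyInt_eq]
  simp only [← map_sub, K₂_toPlane, PiLp.add_apply, PiLp.smul_apply, smul_eq_mul,
    ← integral_mul_const]
  rw [← integral_add (h1.mul_const _) (h3.mul_const _)]
  congr with w
  simp only [Function.comp_apply]
  ring

lemma velocityFun_eq (hf : ContDiff ℝ ∞ f) (hc : HasCompactSupport f) :
    velocityFun f = fun x => cauchyInt (f ∘ toPlane) (toPlane.symm x) • coeffHol +
      Complex.conjCLE (cauchyInt (fun w => (starRingEnd ℂ) (f (toPlane w))) (toPlane.symm x)) •
        coeffAnti := by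
  ext1 x
  have := velocityFun_toPlane hf hc (toPlane.symm x)
  rwa [LinearIsometryEquiv.apply_symm_apply] at this

lemma contDiff_velocityFun (hf : ContDiff ℝ ∞ f) (hc : HasCompactSupport f) :
    ContDiff ℝ ∞ (velocityFun f) := by
  rw [velocityFun_eq hf hc]
  have h1 := contDiff_cauchyInt (contDiff_comp_toPlane hf) (hasCompactSupport_comp_toPlane hc)
  have h2 := contDiff_cauchyInt (contDiff_conj_comp (contDiff_comp_toPlane hf))
    (hasCompactSupport_conj_comp (hasCompactSupport_comp_toPlane hc))
  have h3 : ContDiff ℝ ∞ toPlane.symm := toPlane.symm.toContinuousLinearEquiv.contDiff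
  exact ((h1.comp h3).smul contDiff_const).add
    ((Complex.conjCLE.contDiff.comp (h2.comp h3)).smul contDiff_const)

lemma fderiv_velocityFun (hf : ContDiff ℝ ∞ f) (hc : HasCompactSupport f) (x d : Plane) :
    fderiv ℝ (velocityFun f) x d =
      fderiv ℝ (cauchyInt (f ∘ toPlane)) (toPlane.symm x) (toPlane.symm d) • coeffHol +
      (starRingEnd ℂ) (fderiv ℝ (cauchyInt fun w => (starRingEnd ℂ) (f (toPlane w)))
        (toPlane.symm x) (toPlane.symm d)) • coeffAnti := by
  have h1 := contDiff_cauchyInt (contDiff_comp_toPlane hf) (hasCompactSupport_comp_toPlane hc)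
  have h2 := contDiff_cauchyInt (contDiff_conj_comp (contDiff_comp_toPlane hf))
    (hasCompactSupport_conj_comp (hasCompactSupport_comp_toPlane hc))
  have e1 := toPlane.symm.toContinuousLinearEquiv.hasFDerivAt (x := x)
  have d1 := (h1.differentiable (by simp) (toPlane.symm x)).hasFDerivAt.comp x e1
  have d2 := Complex.conjCLE.hasFDerivAt.comp x
    ((h2.differentiable (by simp) (toPlane.symm x)).hasFDerivAt.comp x e1)
  have h := ((d1.smul_const coeffHol).add (d2.smul_const coeffAnti)).fderiv
  rw [velocityFun_eq hf hc]
  refine (congrArg (fun L => L d) h).trans ?_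
  rfl

/-- The divergence is a multiple of the difference between `∂̄` of the Cauchy transform of `f` and
the conjugate of `∂̄` of that of the conjugate of `f`; both equal `π f`. -/
lemma div_velocityFun (hf : ContDiff ℝ ∞ f) (hc : HasCompactSupport f) (x : Plane) :
    ∑ i : Fin 2, fderiv ℝ (velocityFun f) x (EuclideanSpace.single i 1) i = 0 := by
  have e0 : toPlane.symm (EuclideanSpace.single 0 1) = 1 := by
    rw [LinearIsometryEquiv.symm_apply_eq]
    ext i; fin_cases i <;> simp
  have e1 : toPlane.symm (EuclideanSpace.single 1 1) = Complex.I := by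
    rw [LinearIsometryEquiv.symm_apply_eq]
    ext i; fin_cases i <;> simp
  have w1 := wirtBar_cauchyInt (contDiff_comp_toPlane hf) (hasCompactSupport_comp_toPlane hc)
    (toPlane.symm x)
  have w2 := congrArg (starRingEnd ℂ) (wirtBar_cauchyInt
    (contDiff_conj_comp (contDiff_comp_toPlane hf))
    (hasCompactSupport_conj_comp (hasCompactSupport_comp_toPlane hc)) (toPlane.symm x))
  rw [Fin.sum_univ_two, fderiv_velocityFun hf hc, fderiv_velocityFun hf hc, e0, e1]
  simp only [wirtBar, Function.comp_apply, map_div₀, map_add, map_mul, Complex.conj_I,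
    Complex.conj_conj, Complex.conj_ofReal, map_ofNat, LinearIsometryEquiv.apply_symm_apply]
    at w1 w2
  have hpi : (Real.pi : ℂ) ≠ 0 := by simp [Real.pi_ne_zero]
  have hI : Complex.I ≠ 0 := Complex.I_ne_zero
  have h4 : (4 * Real.pi : ℂ)⁻¹ = Complex.I * (4 * Real.pi * Complex.I)⁻¹ := by field_simp
  have a0 : coeffHol 0 = (4 * Real.pi * Complex.I)⁻¹ := rfl
  have a1 : coeffHol 1 = Complex.I * (4 * Real.pi * Complex.I)⁻¹ := h4
  have b0 : coeffAnti 0 = -(4 * Real.pi * Complex.I)⁻¹ := rfl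
  have b1 : coeffAnti 1 = Complex.I * (4 * Real.pi * Complex.I)⁻¹ := h4
  simp only [PiLp.add_apply, PiLp.smul_apply, smul_eq_mul, a0, a1, b0, b1]
  linear_combination (2 * (4 * Real.pi * Complex.I)⁻¹) * (w1 - w2)

lemma norm_velocityFun_le (hf : ContDiff ℝ ∞ f) (hc : HasCompactSupport f) (x : Plane) :
    ‖velocityFun f x‖ ≤ ‖coeffHol‖ * ‖cauchyInt (f ∘ toPlane) (toPlane.symm x)‖ +
      ‖coeffAnti‖ * ‖cauchyInt (fun w => (starRingEnd ℂ) (f (toPlane w))) (toPlane.symm x)‖ := by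
  rw [velocityFun_eq hf hc]
  refine (norm_add_le _ _).trans (le_of_eq ?_)
  rw [norm_smul, norm_smul, Complex.conjCLE_apply, RCLike.norm_conj, mul_comm, mul_comm ‖coeffAnti‖]

lemma norm_fderiv_velocityFun_le (hf : ContDiff ℝ ∞ f) (hc : HasCompactSupport f) (x : Plane) :
    ‖fderiv ℝ (velocityFun f) x‖ ≤
      ‖coeffHol‖ * ‖fderiv ℝ (cauchyInt (f ∘ toPlane)) (toPlane.symm x)‖ +
      ‖coeffAnti‖ * ‖fderiv ℝ (cauchyInt fun w => (starRingEnd ℂ) (f (toPlane w)))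
        (toPlane.symm x)‖ := by
  refine ContinuousLinearMap.opNorm_le_bound _ (by positivity) fun d => ?_
  rw [fderiv_velocityFun hf hc]
  refine (norm_add_le _ _).trans ?_
  rw [norm_smul, norm_smul, RCLike.norm_conj, add_mul, mul_right_comm, mul_right_comm, mul_comm _ ‖coeffHol‖,
    mul_comm _ ‖coeffAnti‖, mul_assoc, mul_assoc]
  have hd : ‖toPlane.symm d‖ = ‖d‖ := LinearIsometryEquiv.norm_map _ _
  gcongr
  · rw [← hd]; exact ContinuousLinearMap.le_opNorm _ _
  · rw [← hd]; exact ContinuousLinearMap.le_opNorm _ _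

variable {q : ℝ≥0∞}

lemma eLpNorm_le_of_norm_le_toPlane (hq : 1 ≤ q) {E E₁ : Type*} [NormedAddCommGroup E]
    [NormedAddCommGroup E₁] {h : Plane → E} {h₁ h₂ : ℂ → E₁}
    (hm1 : AEStronglyMeasurable h₁) (hm2 : AEStronglyMeasurable h₂) {a b : ℝ≥0}
    (hle : ∀ x, ‖h x‖ ≤ a * ‖h₁ (toPlane.symm x)‖ + b * ‖h₂ (toPlane.symm x)‖) :
    eLpNorm h q volume ≤ a * eLpNorm h₁ q volume + b * eLpNorm h₂ q volume := by
  have hmp : MeasurePreserving toPlane.symm := toPlane.symm.measurePreserving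
  rw [← eLpNorm_comp_measurePreserving hm1 hmp, ← eLpNorm_comp_measurePreserving hm2 hmp]
  have m1 := hm1.comp_measurePreserving hmp
  have m2 := hm2.comp_measurePreserving hmp
  calc eLpNorm h q volume ≤ eLpNorm (fun x => (a : ℝ) • ‖(h₁ ∘ toPlane.symm) x‖ +
          (b : ℝ) • ‖(h₂ ∘ toPlane.symm) x‖) q volume :=
        eLpNorm_mono_real fun x => hle x
    _ ≤ eLpNorm ((a : ℝ) • fun x => ‖(h₁ ∘ toPlane.symm) x‖) q volume +
          eLpNorm ((b : ℝ) • fun x => ‖(h₂ ∘ toPlane.symm) x‖) q volume :=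
        eLpNorm_add_le (m1.norm.const_smul (a : ℝ)) (m2.norm.const_smul (b : ℝ)) hq
    _ = _ := by
        rw [eLpNorm_const_smul, eLpNorm_const_smul, eLpNorm_norm, eLpNorm_norm]
        simp [enorm_eq_nnnorm]

/-- The a priori estimate for the velocity field of a smooth compactly supported vorticity. -/
theorem exists_eLpNorm_velocityFun_le {m : ℕ} (hm : 2 ≤ m) (hq : 2 ≤ q) (hq' : q < ⊤) :
    ∃ C : ℝ≥0, ∀ f : Plane → ℂ, ContDiff ℝ ∞ f → HasCompactSupport f →
      (∀ x, f (rot (2 * Real.pi / m) x) = f x) →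
      eLpNorm (fun x => (‖x‖⁻¹ : ℝ) • velocityFun f x) q volume ≤ C * eLpNorm f q volume ∧
      eLpNorm (fderiv ℝ (velocityFun f)) q volume ≤ C * eLpNorm f q volume := by
  obtain ⟨C, hC⟩ := exists_eLpNorm_cauchyInt_le hm hq hq'
  refine ⟨(‖coeffHol‖₊ + ‖coeffAnti‖₊) * C, fun f hf hc hsym => ?_⟩
  have hq1 : 1 ≤ q := one_le_two.trans hq
  have hg1 := contDiff_comp_toPlane hf
  have hc1 := hasCompactSupport_comp_toPlane hc
  have hg2 := contDiff_conj_comp hg1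
  have hc2 := hasCompactSupport_conj_comp hc1
  have hs : ∀ z, f (toPlane (Complex.exp ((2 * Real.pi / m : ℝ) * Complex.I) * z)) =
      f (toPlane z) := fun z => by rw [toPlane_exp_mul, hsym]
  have b1 := hC (f ∘ toPlane) hg1 hc1 hs
  have b2 := hC (fun w => (starRingEnd ℂ) (f (toPlane w))) hg2 hc2 fun z => by rw [hs]
  have n1 : eLpNorm (f ∘ toPlane) q volume = eLpNorm f q volume :=
    eLpNorm_comp_measurePreserving hf.continuous.aestronglyMeasurable toPlane.measurePreserving
  have n2 : eLpNorm (fun w => (starRingEnd ℂ) (f (toPlane w))) q volume = eLpNorm f q volume := by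
    rw [← n1]
    exact eLpNorm_congr_norm_ae (.of_forall fun w => RCLike.norm_conj _)
  rw [n1] at b1
  rw [n2] at b2
  have hu1 := contDiff_cauchyInt hg1 hc1
  have hu2 := contDiff_cauchyInt hg2 hc2
  have hmi : ∀ u : ℂ → ℂ, Continuous u →
      AEStronglyMeasurable (fun z => (‖z‖⁻¹ : ℝ) • u z) volume := fun u hu =>
    (measurable_norm.inv.smul hu.measurable).aestronglyMeasurable
  have fin : ∀ X : ℝ≥0∞, (‖coeffHol‖₊ : ℝ≥0∞) * (C * X) + ‖coeffAnti‖₊ * (C * X) =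
      ((‖coeffHol‖₊ + ‖coeffAnti‖₊) * C : ℝ≥0) * X := fun X => by push_cast; ring
  constructor
  · refine (eLpNorm_le_of_norm_le_toPlane hq1 (hmi _ hu1.continuous) (hmi _ hu2.continuous)
      (a := ‖coeffHol‖₊) (b := ‖coeffAnti‖₊) fun x => ?_).trans
      ((add_le_add (mul_le_mul_right b1.1 _) (mul_le_mul_right b2.1 _)).trans (le_of_eq (fin _)))
    rw [norm_smul, norm_smul, norm_smul, LinearIsometryEquiv.norm_map, coe_nnnorm, coe_nnnorm,
      mul_left_comm, mul_left_comm ‖coeffAnti‖, ← mul_add]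
    exact mul_le_mul_of_nonneg_left (norm_velocityFun_le hf hc x) (norm_nonneg _)
  · exact (eLpNorm_le_of_norm_le_toPlane hq1 (hu1.continuous_fderiv (by simp)).aestronglyMeasurable
      (hu2.continuous_fderiv (by simp)).aestronglyMeasurable
      (a := ‖coeffHol‖₊) (b := ‖coeffAnti‖₊) (norm_fderiv_velocityFun_le hf hc)).trans
      ((add_le_add (mul_le_mul_right b1.2 _) (mul_le_mul_right b2.2 _)).trans (le_of_eq (fin _)))

end Transfer

/-! ### Uniform bounds for the Biot–Savart integral. -/

section Kernel

lemma norm_K₂ (w : Plane) : ‖K₂ w‖ = (2 * Real.pi)⁻¹ * ‖w‖⁻¹ := by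
  have h : ‖(!₂[-w 1, w 0] : Plane)‖ = ‖w‖ := by
    simp only [EuclideanSpace.norm_eq, Fin.sum_univ_two, Real.norm_eq_abs, sq_abs]
    congr 1
    simp
    ring
  rw [K₂, norm_smul, h, norm_inv, Real.norm_of_nonneg (by positivity)]
  rcases eq_or_ne ‖w‖ 0 with h0 | h0
  · simp [h0]
  · field_simp

lemma measurable_K₂ : Measurable K₂ := by
  have h : Continuous fun x : Plane => (!₂[-x 1, x 0] : Plane) := by
    refine (PiLp.continuous_toLp 2 _).comp (continuous_pi fun i => ?_)
    fin_cases i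
    · simp only [Fin.zero_eta, Matrix.cons_val_zero]; fun_prop
    · simp only [Fin.mk_one, Matrix.cons_val_one]; fun_prop
  exact (by fun_prop : Measurable fun x : Plane => (2 * Real.pi * ‖x‖ ^ 2)⁻¹).smul h.measurable

lemma locallyIntegrable_K₂ : LocallyIntegrable K₂ := by
  refine locallyIntegrable_of_norm_le_rpow (C := (2 * Real.pi)⁻¹) (α := 1) (by simp) (by simp) ?_
    measurable_K₂.aestronglyMeasurable
  refine .of_forall fun w => ?_
  rw [norm_K₂, Real.rpow_neg_one]

/-- The kernel is split at distance one: the near part is integrable and meets the sup bound `A`,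
the far part is at most `1` and meets the `L¹` norm. The factors `2` come from summing the two
components. -/
lemma exists_bound_velocityFun : ∃ κ : ℝ, 0 ≤ κ ∧ ∀ (f : Plane → ℂ) (A : ℝ), Continuous f →
    Integrable f → (∀ y, ‖f y‖ ≤ A) →
    (∀ x i, Integrable fun y => ((K₂ (x - y) i : ℝ) : ℂ) * f y) ∧
      ∀ x, ‖velocityFun f x‖ ≤ κ * A + 2 * ∫ y, ‖f y‖ := by
  set k : Plane → ℝ := (ball 0 1).indicator fun w => ‖K₂ w‖
  have hk : Integrable k := by
    rw [integrable_indicator_iff measurableSet_ball]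
    exact ((locallyIntegrable_K₂.integrableOn_isCompact (isCompact_closedBall 0 1)).mono_set
      ball_subset_closedBall).norm
  have hk0 : ∀ w, 0 ≤ k w := fun w => indicator_nonneg (fun _ _ => norm_nonneg _) w
  refine ⟨2 * ∫ w, k w, mul_nonneg (by norm_num) (integral_nonneg hk0), fun f A hf hfi hA => ?_⟩
  have hpt : ∀ x y i, ‖((K₂ (x - y) i : ℝ) : ℂ) * f y‖ ≤ k (x - y) * A + ‖f y‖ := by
    intro x y i
    have h1 : ‖((K₂ (x - y) i : ℝ) : ℂ)‖ ≤ ‖K₂ (x - y)‖ := by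
      rw [Complex.norm_real]
      exact PiLp.norm_apply_le _ _
    rw [norm_mul]
    by_cases hb : x - y ∈ ball (0 : Plane) 1
    · have : k (x - y) = ‖K₂ (x - y)‖ := indicator_of_mem hb _
      rw [this]
      have := mul_le_mul h1 (hA y) (norm_nonneg _) (norm_nonneg _)
      linarith [norm_nonneg (f y)]
    · have : k (x - y) = 0 := indicator_of_notMem hb _
      rw [this, zero_mul, zero_add]
      refine mul_le_of_le_one_left (norm_nonneg _) (h1.trans ?_)
      rw [norm_K₂]
      rw [mem_ball_zero_iff, not_lt] at hb
      refine mul_le_one₀ (inv_le_one_of_one_le₀ ?_) (by positivity) (inv_le_one_of_one_le₀ hb)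
      linarith [Real.pi_gt_three]
  have hdom : ∀ x, Integrable fun y => k (x - y) * A + ‖f y‖ := fun x =>
    ((hk.comp_sub_left x).mul_const A).add hfi.norm
  have hmeas : ∀ x i, AEStronglyMeasurable (fun y => ((K₂ (x - y) i : ℝ) : ℂ) * f y) volume := by
    intro x i
    have h1 : Measurable fun y => K₂ (x - y) := measurable_K₂.comp (by fun_prop)
    have h2 : Measurable fun y => K₂ (x - y) i := by fun_prop
    exact ((Complex.measurable_ofReal.comp h2).mul hf.measurable).aestronglyMeasurable
  refine ⟨fun x i => (hdom x).mono' (hmeas x i) (.of_forall fun y => hpt x y i), fun x => ?_⟩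
  have hi : ∀ i, ‖∫ y, ((K₂ (x - y) i : ℝ) : ℂ) * f y‖ ≤ (∫ w, k w) * A + ∫ y, ‖f y‖ := by
    intro i
    refine (norm_integral_le_of_norm_le (hdom x) (.of_forall fun y => hpt x y i)).trans
      (le_of_eq ?_)
    rw [integral_add ((hk.comp_sub_left x).mul_const A) hfi.norm, integral_mul_const,
      integral_sub_left_eq_self k volume x]
  have h0 := hi 0
  have h1 := hi 1
  rw [velocityFun, EuclideanSpace.norm_eq, Fin.sum_univ_two]
  simp only
  set a := ‖∫ y, ((K₂ (x - y) 0 : ℝ) : ℂ) * f y‖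
  set b := ‖∫ y, ((K₂ (x - y) 1 : ℝ) : ℂ) * f y‖
  have ha : 0 ≤ a := norm_nonneg _
  have hb : 0 ≤ b := norm_nonneg _
  have : √(a ^ 2 + b ^ 2) ≤ a + b := Real.sqrt_le_iff.2 ⟨by positivity, by nlinarith⟩
  linarith

lemma velocityFun_add {f g : Plane → ℂ}
    (hf : ∀ x i, Integrable fun y => ((K₂ (x - y) i : ℝ) : ℂ) * f y)
    (hg : ∀ x i, Integrable fun y => ((K₂ (x - y) i : ℝ) : ℂ) * g y) :
    velocityFun (f + g) = velocityFun f + velocityFun g := by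
  ext x i
  simp only [velocityFun, Pi.add_apply, PiLp.add_apply, mul_add]
  exact integral_add (hf x i) (hg x i)

lemma velocityFun_smul (c : ℂ) (f : Plane → ℂ) : velocityFun (c • f) = c • velocityFun f := by
  ext x i
  simp only [velocityFun, Pi.smul_apply, PiLp.smul_apply, smul_eq_mul, ← integral_const_mul]
  congr with y
  ring

end Kernel

/-! ### Density of smooth compactly supported symmetric functions. -/

section Symmetric

variable (m : ℕ)

/-- The smooth compactly supported `m`-fold symmetric functions on the plane. -/
def symSmooth : Submodule ℂ (Plane → ℂ) where
  carrier := {f | ContDiff ℝ ∞ f ∧ HasCompactSupport f ∧ ∀ x, f (rot (2 * Real.pi / m) x) = f x}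
  add_mem' {f g} hf hg := ⟨hf.1.add hg.1, hf.2.1.add hg.2.1, fun x => by
    rw [Pi.add_apply, Pi.add_apply, hf.2.2, hg.2.2]⟩
  zero_mem' := ⟨contDiff_const, HasCompactSupport.zero, fun _ => rfl⟩
  smul_mem' c f hf := ⟨hf.1.const_smul c, hf.2.1.mono fun x hx hx' => hx (by simp [hx']),
    fun x => by rw [Pi.smul_apply, Pi.smul_apply, hf.2.2]⟩

variable {m}

lemma symSmooth.memLp (f : symSmooth m) (q : ℝ≥0∞) : MemLp (f : Plane → ℂ) q volume :=
  f.2.1.continuous.memLp_of_hasCompactSupport f.2.2.1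

lemma symSmooth.integrable_kernel (f : symSmooth m) (x : Plane) (i : Fin 2) :
    Integrable fun y => ((K₂ (x - y) i : ℝ) : ℂ) * (f : Plane → ℂ) y := by
  obtain ⟨κ, -, hκ⟩ := exists_bound_velocityFun
  obtain ⟨A, hA⟩ := f.2.1.continuous.bounded_above_of_compact_support f.2.2.1
  exact (hκ f A f.2.1.continuous (memLp_one_iff_integrable.1 (symSmooth.memLp f 1)) hA).1 x i

/-- The inclusion of the smooth compactly supported symmetric functions into `L^q_m`. -/
def symSmooth.toLqm (q : ℝ≥0∞) [Fact (1 ≤ q)] : symSmooth m →ₗ[ℂ] Lqm q m where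
  toFun f := ⟨(symSmooth.memLp f q).toLp f, by
    have h := (symSmooth.memLp f q).coeFn_toLp
    have h' := (rot (2 * Real.pi / m)).measurePreserving.quasiMeasurePreserving.ae h
    filter_upwards [h, h'] with x h1 h2
    rw [h1, h2, f.2.2.2]⟩
  map_add' f g := Subtype.ext (MemLp.toLp_add (symSmooth.memLp f q) (symSmooth.memLp g q))
  map_smul' c f := Subtype.ext (MemLp.toLp_const_smul c (symSmooth.memLp f q))

lemma symSmooth.coeFn_toLqm (q : ℝ≥0∞) [Fact (1 ≤ q)] (f : symSmooth m) :
    (symSmooth.toLqm q f : Lp ℂ q (volume : Measure Plane)) =ᵐ[volume] f :=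
  (symSmooth.memLp f q).coeFn_toLp

lemma rot_iterate (hm : m ≠ 0) (x : Plane) : (rot (2 * Real.pi / m))^[m] x = x := by
  obtain ⟨z, rfl⟩ := toPlane.surjective x
  have h : ∀ n : ℕ, (rot (2 * Real.pi / m))^[n] (toPlane z) =
      toPlane (Complex.exp ((2 * Real.pi / m : ℝ) * Complex.I) ^ n * z) := by
    intro n
    induction n with
    | zero => simp
    | succ n ih => rw [Function.iterate_succ_apply', ih, ← toPlane_exp_mul, pow_succ', mul_assoc]
  rw [h]
  have := (Complex.isPrimitiveRoot_exp m hm).pow_eq_one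
  have e : Complex.exp ((2 * Real.pi / m : ℝ) * Complex.I) = Complex.exp (2 * Real.pi * Complex.I / m) := by
    congr 1
    push_cast
    ring
  rw [e, this, one_mul]

/-- The average of a function over the rotations by multiples of `2π/m`. -/
def rotAverage (m : ℕ) (g : Plane → ℂ) (x : Plane) : ℂ :=
  (m : ℂ)⁻¹ * ∑ k ∈ Finset.range m, g ((rot (2 * Real.pi / m))^[k] x)

lemma rotAverage_mem (hm : m ≠ 0) {g : Plane → ℂ} (hg : ContDiff ℝ ∞ g)
    (hc : HasCompactSupport g) : rotAverage m g ∈ symSmooth m := by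
  set R := rot (2 * Real.pi / m)
  have hR : ∀ k : ℕ, ContDiff ℝ ∞ (R^[k]) := fun k => by
    induction k with
    | zero => exact contDiff_id
    | succ k ih =>
      rw [Function.iterate_succ']
      exact R.toContinuousLinearEquiv.contDiff.comp ih
  have hRc : ∀ k : ℕ, HasCompactSupport fun x => g (R^[k] x) := fun k => by
    induction k with
    | zero => exact hc
    | succ k ih =>
      simp only [Function.iterate_succ, Function.comp_apply]
      exact ih.comp_homeomorph R.toHomeomorph
  refine ⟨contDiff_const.mul (ContDiff.sum fun k _ => hg.comp (hR k)), ?_, fun x => ?_⟩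
  · refine HasCompactSupport.mul_left ?_
    have : ∀ n : ℕ, HasCompactSupport fun x => ∑ k ∈ Finset.range n, g (R^[k] x) := by
      intro n
      induction n with
      | zero => simp only [Finset.range_zero, Finset.sum_empty]; exact HasCompactSupport.zero
      | succ n ih =>
        simp only [Finset.sum_range_succ]
        exact ih.add (hRc n)
    exact this m
  · simp only [rotAverage]
    congr 1
    -- The sum over `0, …, m` is split off at either end; the two extreme terms agree because the
    -- `m`-th iterate is the identity.
    have h1 := Finset.sum_range_succ (fun k => g (R^[k] x)) m
    rw [Finset.sum_range_succ', rot_iterate hm] at h1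
    simpa using h1

/-- Averaging over the rotations fixes `φ` and does not increase `L^q` norms, so the average of any
smooth approximant is at least as good a bound away from `φ` as the approximant itself is guaranteed
to be. -/
lemma denseRange_toLqm (hm : m ≠ 0) {q : ℝ≥0∞} [Fact (1 ≤ q)] (hq' : q ≠ ⊤) :
    DenseRange (symSmooth.toLqm (m := m) q) := by
  intro φ
  rw [Metric.mem_closure_range_iff]
  intro ε hε
  obtain ⟨g, hc, hg, hle⟩ := MemLp.exist_eLpNorm_sub_le hq' Fact.out
    (Lp.memLp (φ : Lp ℂ q (volume : Measure Plane))) (half_pos hε)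
  let f : symSmooth m := ⟨rotAverage m g, rotAverage_mem hm hg hc⟩
  refine ⟨f, ?_⟩
  set R := rot (2 * Real.pi / m)
  set Φ : Plane → ℂ := ⇑(φ : Lp ℂ q (volume : Measure Plane))
  have hRm : ∀ k : ℕ, MeasurePreserving (R^[k]) := fun k => R.measurePreserving.iterate k
  have hΦ : ∀ k : ℕ, (fun x => Φ (R^[k] x)) =ᵐ[volume] Φ := by
    intro k
    induction k with
    | zero => exact .rfl
    | succ k ih =>
      have h1 : ∀ᵐ x, Φ (R x) = Φ x := φ.2
      filter_upwards [ih, (hRm k).quasiMeasurePreserving.ae h1] with x h2 h3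
      rw [Function.iterate_succ_apply', h3, h2]
  have hm' : (m : ℂ) ≠ 0 := by exact_mod_cast hm
  have hd : (fun x => Φ x - (f : Plane → ℂ) x) =ᵐ[volume]
      (m : ℂ)⁻¹ • ∑ k ∈ Finset.range m, (Φ - g) ∘ R^[k] := by
    have h2 : ∀ᵐ x, ∀ k ∈ Finset.range m, Φ (R^[k] x) = Φ x :=
      (Finset.eventually_all _).2 fun k _ => hΦ k
    filter_upwards [h2] with x hx
    simp only [Pi.smul_apply, Finset.sum_apply, Function.comp_apply, Pi.sub_apply,
      Finset.sum_sub_distrib, smul_eq_mul, f, rotAverage]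
    change _ - _ * ∑ k ∈ Finset.range m, g (R^[k] x) = _
    rw [Finset.sum_congr rfl hx]
    simp only [Finset.sum_const, Finset.card_range, nsmul_eq_mul]
    field_simp
  have hΦm : AEStronglyMeasurable Φ volume := Lp.aestronglyMeasurable _
  have hsub : AEStronglyMeasurable (Φ - g) volume := hΦm.sub hg.continuous.aestronglyMeasurable
  have hnorm : eLpNorm (fun x => Φ x - (f : Plane → ℂ) x) q volume ≤ ENNReal.ofReal (ε / 2) := by
    rw [eLpNorm_congr_ae hd, eLpNorm_const_smul]
    calc ‖(m : ℂ)⁻¹‖ₑ * eLpNorm (∑ k ∈ Finset.range m, (Φ - g) ∘ R^[k]) q volume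
        ≤ ‖(m : ℂ)⁻¹‖ₑ * ∑ k ∈ Finset.range m, eLpNorm ((Φ - g) ∘ R^[k]) q volume := by
          gcongr
          exact eLpNorm_sum_le (fun k _ => hsub.comp_measurePreserving (hRm k)) Fact.out
      _ ≤ ‖(m : ℂ)⁻¹‖ₑ * ∑ k ∈ Finset.range m, ENNReal.ofReal (ε / 2) := by
          gcongr with k
          rw [eLpNorm_comp_measurePreserving hsub (hRm k)]
          exact hle
      _ = (‖(m : ℂ)⁻¹‖ₑ * m) * ENNReal.ofReal (ε / 2) := by
          simp [mul_assoc]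
      _ = ENNReal.ofReal (ε / 2) := by
          rw [enorm_inv hm']
          have : ‖(m : ℂ)‖ₑ = m := by
            rw [← ofReal_norm]; simp
          rw [this, ENNReal.inv_mul_cancel (by exact_mod_cast hm) (by simp), one_mul]
  rw [Subtype.dist_eq, Lp.dist_def]
  have heq : eLpNorm (fun x => Φ x - (symSmooth.toLqm q f : Lp ℂ q (volume : Measure Plane)) x) q
      volume = eLpNorm (fun x => Φ x - (f : Plane → ℂ) x) q volume := by
    refine eLpNorm_congr_ae ?_
    filter_upwards [symSmooth.coeFn_toLqm q f] with x hx
    rw [hx]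
  refine lt_of_le_of_lt ?_ (half_lt_self hε)
  refine ENNReal.toReal_le_of_le_ofReal (half_pos hε).le ?_
  exact (le_of_eq heq).trans hnorm

/-- A symmetric Schwartz function is approximated by smooth compactly supported symmetric functions,
with an error controlled by a Schwartz function. -/
lemma exists_symSmooth_approx (f : 𝓢(Plane, ℂ)) (hf : ∀ x, f (rot (2 * Real.pi / m) x) = f x) :
    ∃ (F : 𝓢(Plane, ℂ)) (fn : ℕ → symSmooth m), ∀ n x,
      ‖f x - (fn n : Plane → ℂ) x‖ ≤ (n + 1 : ℝ)⁻¹ * ‖F x‖ := by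
  have hw : (fun x : Plane => ((1 + ‖x‖ ^ 2 : ℝ) : ℂ)).HasTemperateGrowth := by fun_prop
  -- The cutoff is radial, so symmetry survives, and equals `1` for `‖x‖ ≤ n + 1`. Beyond that
  -- radius `1 ≤ (n + 1)⁻¹ (1 + ‖x‖²)`, hence the dominating function `F = (1 + ‖x‖²) f`.
  let χ : ℕ → Plane → ℝ := fun n x => Real.smoothTransition (2 - ‖x‖ ^ 2 / (n + 1) ^ 2)
  have hχ : ∀ n, ContDiff ℝ ∞ (χ n) := fun n =>
    Real.smoothTransition.contDiff.comp (contDiff_const.sub ((contDiff_norm_sq ℝ).div_const _))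
  refine ⟨SchwartzMap.smulLeftCLM ℂ (fun x : Plane => ((1 + ‖x‖ ^ 2 : ℝ) : ℂ)) f, fun n =>
    ⟨fun x => χ n x * f x, (Complex.ofRealCLM.contDiff.comp (hχ n)).mul (f.smooth ⊤), ?_, ?_⟩, ?_⟩
  · refine HasCompactSupport.intro (isCompact_closedBall (0 : Plane) (2 * (n + 1))) fun x hx => ?_
    rw [mem_closedBall_zero_iff, not_le] at hx
    have : χ n x = 0 := by
      refine Real.smoothTransition.zero_of_nonpos ?_
      rw [sub_nonpos, le_div_iff₀ (by positivity)]
      have : (0 : ℝ) < n + 1 := by positivity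
      nlinarith
    simp [this]
  · intro x
    simp only [χ, hf, LinearIsometryEquiv.norm_map]
  · intro n x
    rw [SchwartzMap.smulLeftCLM_apply_apply hw, norm_smul, Complex.norm_real,
      Real.norm_of_nonneg (by positivity)]
    have h0 : 0 ≤ χ n x := Real.smoothTransition.nonneg _
    have h1 : χ n x ≤ 1 := Real.smoothTransition.le_one _
    have hn : (0 : ℝ) < n + 1 := by positivity
    have e : f x - χ n x * f x = ((1 - χ n x : ℝ) : ℂ) * f x := by push_cast; ring
    simp only
    rw [e, norm_mul, Complex.norm_real, Real.norm_of_nonneg (by linarith), ← mul_assoc]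
    gcongr
    rcases le_or_gt ‖x‖ (n + 1) with h | h
    · have : χ n x = 1 := by
        refine Real.smoothTransition.one_of_one_le ?_
        have : ‖x‖ ^ 2 / (n + 1) ^ 2 ≤ 1 := by
          rw [div_le_one (by positivity)]
          gcongr
        linarith
      rw [this, sub_self]
      positivity
    · have h2 : 1 ≤ (n + 1 : ℝ)⁻¹ * (1 + ‖x‖ ^ 2) := by
        rw [inv_mul_eq_div, one_le_div hn]
        nlinarith [norm_nonneg x, sq_nonneg (‖x‖ - 1)]
      linarith

end Symmetric

/-! ### Extension by density and the operator `T`. -/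

section Operator

variable {q : ℝ≥0∞} [Fact (1 ≤ q)] {m : ℕ}

lemma symSmooth.velocityFun_add (f g : symSmooth m) :
    velocityFun ((f + g : symSmooth m) : Plane → ℂ) = velocityFun f + velocityFun g :=
  BiotSavart.velocityFun_add (symSmooth.integrable_kernel f) (symSmooth.integrable_kernel g)

lemma symSmooth.velocityFun_smul (c : ℂ) (f : symSmooth m) :
    velocityFun ((c • f : symSmooth m) : Plane → ℂ) = c • velocityFun f :=
  BiotSavart.velocityFun_smul c f

lemma symSmooth.contDiff_velocityFun (f : symSmooth m) : ContDiff ℝ ∞ (velocityFun f) :=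
  BiotSavart.contDiff_velocityFun f.2.1 f.2.2.1

lemma symSmooth.differentiable_velocityFun (f : symSmooth m) :
    Differentiable ℝ (velocityFun f) :=
  (symSmooth.contDiff_velocityFun f).differentiable (by simp)

/-- A linear map on the smooth compactly supported symmetric functions with an `L^q` bound extends
to `L^q_m`. -/
lemma exists_extension (hm : m ≠ 0) (hq' : q ≠ ⊤) {F : Type*} [NormedAddCommGroup F]
    [NormedSpace ℂ F] [CompleteSpace F] (G : symSmooth m →ₗ[ℂ] Plane → F) (C : ℝ≥0)
    (hG : ∀ f, AEStronglyMeasurable (G f) volume)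
    (hC : ∀ f : symSmooth m, eLpNorm (G f) q volume ≤ C * eLpNorm (f : Plane → ℂ) q volume) :
    ∃ A : Lqm q m →L[ℂ] Lp F q (volume : Measure Plane),
      (∀ φ, ‖A φ‖ ≤ C * ‖φ‖) ∧ ∀ f : symSmooth m, A (symSmooth.toLqm q f) =ᵐ[volume] G f := by
  have hfin : ∀ f : symSmooth m, (C : ℝ≥0∞) * eLpNorm (f : Plane → ℂ) q volume < ⊤ := fun f =>
    ENNReal.mul_lt_top ENNReal.coe_lt_top (symSmooth.memLp f q).2
  have hL : ∀ f : symSmooth m, MemLp (G f) q volume := fun f => ⟨hG f, (hC f).trans_lt (hfin f)⟩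
  let A₀ : symSmooth m →ₗ[ℂ] Lp F q (volume : Measure Plane) :=
    { toFun := fun f => (hL f).toLp _
      map_add' := fun f g => by
        rw [← MemLp.toLp_add]
        exact MemLp.toLp_congr _ _ (.of_forall fun x => by rw [map_add])
      map_smul' := fun c f => by
        rw [RingHom.id_apply, ← MemLp.toLp_const_smul]
        exact MemLp.toLp_congr _ _ (.of_forall fun x => by rw [map_smul]) }
  have hnorm : ∀ f : symSmooth m, ‖symSmooth.toLqm q f‖ = (eLpNorm (f : Plane → ℂ) q volume).toReal := fun f =>
    Lp.norm_toLp _ (symSmooth.memLp f q)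
  have hA₀ : ∀ f, ‖A₀ f‖ ≤ C * ‖symSmooth.toLqm q f‖ := fun f => by
    rw [hnorm, ← ENNReal.coe_toReal, ← ENNReal.toReal_mul]
    exact (Lp.norm_toLp _ (hL f)).le.trans (ENNReal.toReal_mono (hfin f).ne (hC f))
  have hd : DenseRange (symSmooth.toLqm (m := m) q) := denseRange_toLqm hm hq'
  refine ⟨A₀.extendOfNorm (symSmooth.toLqm q), LinearMap.norm_extendOfNorm_apply_le hd C hA₀,
    fun f => ?_⟩
  rw [LinearMap.extendOfNorm_eq hd ⟨C, hA₀⟩]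
  exact (hL f).coeFn_toLp

/-- The linear map `f ↦ |x|⁻¹ (K₂ * f)`. -/
def symSmooth.weightedVelocity : symSmooth m →ₗ[ℂ] Plane → Vel where
  toFun f x := (‖x‖⁻¹ : ℝ) • velocityFun f x
  map_add' f g := by
    ext1 x
    rw [symSmooth.velocityFun_add, Pi.add_apply, Pi.add_apply, smul_add]
  map_smul' c f := by
    ext1 x
    rw [symSmooth.velocityFun_smul, Pi.smul_apply, RingHom.id_apply, Pi.smul_apply, smul_comm]

/-- The linear map `f ↦ D (K₂ * f)`. -/
def symSmooth.fderivVelocity : symSmooth m →ₗ[ℂ] Plane → Plane →L[ℝ] Vel where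
  toFun f := fderiv ℝ (velocityFun f)
  map_add' f g := by
    ext1 x
    rw [symSmooth.velocityFun_add, Pi.add_apply, fderiv_add
      (symSmooth.differentiable_velocityFun f x) (symSmooth.differentiable_velocityFun g x)]
  map_smul' c f := by
    ext1 x
    rw [symSmooth.velocityFun_smul, RingHom.id_apply, Pi.smul_apply, fderiv_const_smul
      (symSmooth.differentiable_velocityFun f x)]

/-- The bounded extension to `L^q_m` of `f ↦ |x|⁻¹ (K₂ * f)`. -/
lemma exists_extension_weightedVelocity (hm : 2 ≤ m) (hq : 2 ≤ q) (hq' : q < ⊤) :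
    ∃ (C : ℝ≥0) (A : Lqm q m →L[ℂ] Lp Vel q (volume : Measure Plane)),
      (∀ φ, ‖A φ‖ ≤ C * ‖φ‖) ∧
      ∀ f : symSmooth m, A (symSmooth.toLqm q f) =ᵐ[volume] symSmooth.weightedVelocity f := by
  obtain ⟨C, hC⟩ := exists_eLpNorm_velocityFun_le hm hq hq'
  have h1 := fun f : symSmooth m => (hC f f.2.1 f.2.2.1 f.2.2.2).1
  have h2 : ∀ f : symSmooth m, AEStronglyMeasurable (symSmooth.weightedVelocity f) volume :=
    fun f => ((by fun_prop : Measurable fun x : Plane => ‖x‖⁻¹).smul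
      (symSmooth.contDiff_velocityFun f).continuous.measurable).aestronglyMeasurable
  obtain ⟨A, hA⟩ := exists_extension (m := m) (by omega) hq'.ne symSmooth.weightedVelocity C h2 h1
  exact ⟨C, A, hA⟩

/-- The bounded extension to `L^q_m` of `f ↦ D (K₂ * f)`. -/
lemma exists_extension_fderivVelocity (hm : 2 ≤ m) (hq : 2 ≤ q) (hq' : q < ⊤) :
    ∃ (C : ℝ≥0) (B : Lqm q m →L[ℂ] Lp (Plane →L[ℝ] Vel) q (volume : Measure Plane)),
      (∀ φ, ‖B φ‖ ≤ C * ‖φ‖) ∧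
      ∀ f : symSmooth m, B (symSmooth.toLqm q f) =ᵐ[volume] symSmooth.fderivVelocity f := by
  obtain ⟨C, hC⟩ := exists_eLpNorm_velocityFun_le hm hq hq'
  have h1 := fun f : symSmooth m => (hC f f.2.1 f.2.2.1 f.2.2.2).2
  have h2 : ∀ f : symSmooth m, AEStronglyMeasurable (symSmooth.fderivVelocity f) volume :=
    fun f => ((symSmooth.contDiff_velocityFun f).continuous_fderiv (by simp)).aestronglyMeasurable
  obtain ⟨B, hB⟩ := exists_extension (m := m) (by omega) hq'.ne symSmooth.fderivVelocity C h2 h1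
  exact ⟨C, B, hB⟩

lemma integrable_schwartz_smul {F : Type*} [NormedAddCommGroup F] [NormedSpace ℂ F]
    (ψ : 𝓢(Plane, ℂ)) (u : Lp F q (volume : Measure Plane)) :
    Integrable fun x => ψ x • u x := by
  have := ENNReal.HolderConjugate.inv_one_sub_inv' (Fact.out : 1 ≤ q)
  rw [← memLp_one_iff_integrable]
  exact (Lp.memLp u).smul (ψ.memLp (1 - q⁻¹)⁻¹ volume)

/-- A bounded function with the growth of the norm after multiplication by `1 + |x|²`. -/
def dampedNorm (x : Plane) : ℂ := ((‖x‖ * (1 + ‖x‖ ^ 2)⁻¹ : ℝ) : ℂ)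

lemma memLp_dampedNorm : MemLp dampedNorm ⊤ (volume : Measure Plane) := by
  refine memLp_top_of_bound (C := 1) ?_ (.of_forall fun x => ?_)
  · exact (Complex.measurable_ofReal.comp
      (by fun_prop : Measurable fun x : Plane => ‖x‖ * (1 + ‖x‖ ^ 2)⁻¹)).aestronglyMeasurable
  · rw [dampedNorm, Complex.norm_real, Real.norm_of_nonneg (by positivity), ← div_eq_mul_inv,
      div_le_one (by positivity)]
    nlinarith [sq_nonneg (‖x‖ - 1)]

/-- The tempered distribution given by `x ↦ |x| u(x)` for `u ∈ L^q`. -/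
def normSMulDistrib (q : ℝ≥0∞) [Fact (1 ≤ q)] :
    Lp Vel q (volume : Measure Plane) →L[ℂ] 𝓢'(Plane, Vel) :=
  -- The function `|x|` is not smooth, so it is factored as `1 + |x|²`, a smooth multiplier of
  -- tempered distributions, times the bounded `dampedNorm`, which acts on `L^q`.
  TemperedDistribution.smulLeftCLM Vel (fun x : Plane => ((1 + ‖x‖ ^ 2 : ℝ) : ℂ)) ∘L
    Lp.toTemperedDistributionCLM Vel volume q ∘L
    (ContinuousLinearMap.lsmul ℂ ℂ).holderL volume ⊤ q q memLp_dampedNorm.toLp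

lemma isGivenBy_normSMulDistrib (u : Lp Vel q (volume : Measure Plane)) :
    IsGivenBy (normSMulDistrib q u) fun x => ‖x‖ • u x := by
  refine ⟨((Lp.memLp u).locallyIntegrable Fact.out).continuous_smul continuous_norm, fun ψ => ?_⟩
  set M : Lp Vel q (volume : Measure Plane) :=
    (ContinuousLinearMap.lsmul ℂ ℂ).holderL volume ⊤ q q memLp_dampedNorm.toLp u
  have hM : M =ᵐ[volume] fun x => dampedNorm x • u x := by
    filter_upwards [(ContinuousLinearMap.lsmul ℂ ℂ).coeFn_holder (r := q) memLp_dampedNorm.toLp u,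
      memLp_dampedNorm.coeFn_toLp] with x h1 h2
    rw [← h2]
    exact h1
  have hw : (fun x : Plane => ((1 + ‖x‖ ^ 2 : ℝ) : ℂ)).HasTemperateGrowth := by fun_prop
  set χ := SchwartzMap.smulLeftCLM ℂ (fun x : Plane => ((1 + ‖x‖ ^ 2 : ℝ) : ℂ)) ψ
  have hχ : (fun x => χ x • M x) =ᵐ[volume] fun x => ψ x • ‖x‖ • u x := by
    filter_upwards [hM] with x hx
    rw [hx, SchwartzMap.smulLeftCLM_apply_apply hw, dampedNorm, smul_smul, smul_eq_mul,
      ← Complex.coe_smul, smul_smul]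
    congr 1
    have : ((1 + ‖x‖ ^ 2 : ℝ) : ℂ) ≠ 0 := by
      exact_mod_cast (by positivity : (1 + ‖x‖ ^ 2 : ℝ) ≠ 0)
    push_cast at this ⊢
    field_simp
  refine ⟨(integrable_congr hχ).1 (integrable_schwartz_smul χ M), ?_⟩
  rw [← integral_congr_ae hχ]
  exact Lp.toTemperedDistribution_apply M χ

end Operator

/-! ### Agreement with the convolution, weak derivative, divergence and uniqueness. -/

section Properties

variable {q : ℝ≥0∞} [Fact (1 ≤ q)] {m : ℕ}

lemma ae_ne_zero : ∀ᵐ x : Plane, x ≠ 0 := by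
  simp [ae_iff]

/-- A real test function as a complex Schwartz function. -/
def ofRealSchwartz (ψ : Plane → ℝ) (hψ : ContDiff ℝ ∞ ψ) (hc : HasCompactSupport ψ) :
    𝓢(Plane, ℂ) :=
  HasCompactSupport.toSchwartzMap (f := fun x => (ψ x : ℂ))
    (hc.comp_left (g := Complex.ofReal) Complex.ofReal_zero) (Complex.ofRealCLM.contDiff.comp hψ)

lemma ofRealSchwartz_smul {F : Type*} [NormedAddCommGroup F] [NormedSpace ℂ F]
    (ψ : Plane → ℝ) (hψ : ContDiff ℝ ∞ ψ) (hc : HasCompactSupport ψ) (x : Plane) (w : F) :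
    ofRealSchwartz ψ hψ hc x • w = ψ x • w :=
  Complex.coe_smul (ψ x) w

lemma contDiff_fderiv_apply_const {ψ : Plane → ℝ} (hψ : ContDiff ℝ ∞ ψ) (e : Plane) :
    ContDiff ℝ ∞ fun x => fderiv ℝ ψ x e :=
  (hψ.fderiv_right (m := ∞) (by simp)).clm_apply contDiff_const

lemma hasCompactSupport_fderiv_apply_const {ψ : Plane → ℝ} (hc : HasCompactSupport ψ) (e : Plane) :
    HasCompactSupport fun x => fderiv ℝ ψ x e :=
  hc.fderiv_apply (𝕜 := ℝ) e

/-- The trace of a real-linear map from the plane to the space of velocities. -/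
def divTrace : (Plane →L[ℝ] Vel) →L[ℝ] ℂ :=
  ∑ i : Fin 2, (EuclideanSpace.proj i : Vel →L[ℂ] ℂ).restrictScalars ℝ ∘L
    ContinuousLinearMap.apply ℝ Vel (EuclideanSpace.single i 1)

lemma divTrace_apply (L : Plane →L[ℝ] Vel) :
    divTrace L = ∑ i : Fin 2, L (EuclideanSpace.single i 1) i := by
  simp [divTrace]

/-- Domination of the error by `F / (n + 1)` controls it in `L^q`, `L¹` and sup norm at once:
vorticities converge in `L^q_m` while velocities converge uniformly. -/
lemma exists_uniform_approx (φ : Lqm q m) (f : 𝓢(Plane, ℂ))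
    (hφ : (φ : Lp ℂ q (volume : Measure Plane)) =ᵐ[volume] f) :
    ∃ (fn : ℕ → symSmooth m) (K : ℝ),
      Filter.Tendsto (fun n => symSmooth.toLqm q (fn n)) Filter.atTop (nhds φ) ∧
      (∀ x, ‖velocityFun f x‖ ≤ K) ∧
      ∀ n x, ‖velocityFun f x - velocityFun (fn n) x‖ ≤ (n + 1 : ℝ)⁻¹ * K := by
  -- The symmetry of `φ` holds only almost everywhere; continuity of `f` makes it hold everywhere.
  have hs : ∀ x, f (rot (2 * Real.pi / m) x) = f x := by
    have h1 : ∀ᵐ x, (φ : Lp ℂ q (volume : Measure Plane)) (rot (2 * Real.pi / m) x) =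
      (φ : Lp ℂ q (volume : Measure Plane)) x := φ.2
    have h2 : (fun x => f (rot (2 * Real.pi / m) x)) =ᵐ[volume] f := by
      filter_upwards [h1, hφ,
        (rot (2 * Real.pi / m)).measurePreserving.quasiMeasurePreserving.ae hφ] with x h1 h2 h3
      rw [← h3, h1, h2]
    exact congrFun ((f.continuous.comp (rot (2 * Real.pi / m)).continuous).ae_eq_iff_eq volume
      f.continuous |>.1 h2)
  obtain ⟨F, fn, hF⟩ := exists_symSmooth_approx f hs
  obtain ⟨κ, hκ0, hκ⟩ := exists_bound_velocityFun
  obtain ⟨a, -, ha⟩ := f.decay 0 0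
  obtain ⟨b, -, hb⟩ := F.decay 0 0
  simp only [pow_zero, one_mul, norm_iteratedFDeriv_zero] at ha hb
  have hf := hκ f a f.continuous f.integrable ha
  have hn0 : ∀ n : ℕ, (0 : ℝ) ≤ (n + 1 : ℝ)⁻¹ := fun n => by positivity
  have hdc : ∀ n, Continuous fun x => f x - (fn n : Plane → ℂ) x := fun n =>
    f.continuous.sub (fn n).2.1.continuous
  have hd := fun n => hκ (fun x => f x - (fn n : Plane → ℂ) x) ((n + 1 : ℝ)⁻¹ * b) (hdc n)
    (f.integrable.sub (memLp_one_iff_integrable.1 (symSmooth.memLp (fn n) 1)))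
    (fun x => (hF n x).trans (mul_le_mul_of_nonneg_left (hb x) (hn0 n)))
  refine ⟨fn, max (κ * a + 2 * ∫ y, ‖f y‖) (κ * b + 2 * ∫ y, ‖F y‖), ?_,
    fun x => (hf.2 x).trans (le_max_left _ _), fun n x => ?_⟩
  · rw [tendsto_iff_norm_sub_tendsto_zero]
    have hlim : Filter.Tendsto (fun n : ℕ => (n + 1 : ℝ)⁻¹ * (eLpNorm F q volume).toReal)
        Filter.atTop (nhds 0) := by
      simpa using (tendsto_one_div_add_atTop_nhds_zero_nat (𝕜 := ℝ)).mul_const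
        (eLpNorm F q volume).toReal
    refine squeeze_zero (fun _ => norm_nonneg _) (fun n => ?_) hlim
    rw [← Submodule.norm_coe, Submodule.coe_sub, Lp.norm_def]
    have h1 : eLpNorm ((symSmooth.toLqm q (fn n) : Lp ℂ q (volume : Measure Plane)) -
        (φ : Lp ℂ q (volume : Measure Plane)) : Lp ℂ q (volume : Measure Plane)) q volume ≤
        ENNReal.ofReal (n + 1 : ℝ)⁻¹ * eLpNorm F q volume := by
      refine eLpNorm_le_mul_eLpNorm_of_ae_le_mul ?_ q
      filter_upwards [Lp.coeFn_sub (symSmooth.toLqm q (fn n) : Lp ℂ q (volume : Measure Plane))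
        (φ : Lp ℂ q (volume : Measure Plane)), symSmooth.coeFn_toLqm q (fn n), hφ] with x h1 h2 h3
      rw [h1, Pi.sub_apply, h2, h3, norm_sub_rev]
      exact hF n x
    refine (ENNReal.toReal_mono (ENNReal.mul_ne_top ENNReal.ofReal_ne_top
      (F.memLp q volume).2.ne) h1).trans ?_
    rw [ENNReal.toReal_mul, ENNReal.toReal_ofReal (hn0 n)]
  · have h1 : velocityFun f = velocityFun (fun x => f x - (fn n : Plane → ℂ) x) +
        velocityFun (fn n) := by
      rw [← velocityFun_add (hd n).1 (symSmooth.integrable_kernel (fn n))]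
      congr 1
      ext x
      simp
    rw [h1, Pi.add_apply, add_sub_cancel_right]
    refine ((hd n).2 x).trans ?_
    have h2 : ∫ y, ‖f y - (fn n : Plane → ℂ) y‖ ≤ (n + 1 : ℝ)⁻¹ * ∫ y, ‖F y‖ := by
      rw [← integral_const_mul]
      exact integral_mono_of_nonneg (.of_forall fun _ => norm_nonneg _)
        (F.integrable.norm.const_mul _) (.of_forall (hF n))
    calc κ * ((n + 1 : ℝ)⁻¹ * b) + 2 * ∫ y, ‖f y - (fn n : Plane → ℂ) y‖
        ≤ (n + 1 : ℝ)⁻¹ * (κ * b + 2 * ∫ y, ‖F y‖) := by linarith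
      _ ≤ _ := mul_le_mul_of_nonneg_left (le_max_right _ _) (hn0 n)

/-- Smooth compactly supported functions are Schwartz, so both maps are prescribed on a dense set;
continuity suffices and linearity plays no role. -/
lemma eq_of_extendsConv (hd : DenseRange (symSmooth.toLqm (m := m) q))
    {T T' : Lqm q m → 𝓢'(Plane, Vel)} (hT : Continuous T) (hT' : Continuous T')
    (h : ExtendsConv T) (h' : ExtendsConv T') : T' = T := by
  refine hd.equalizer hT' hT ?_
  ext f ψ : 2
  have hf : (symSmooth.toLqm q f : Lp ℂ q (volume : Measure Plane)) =ᵐ[volume]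
      HasCompactSupport.toSchwartzMap f.2.2.1 f.2.1 := symSmooth.coeFn_toLqm q f
  simp only [Function.comp_apply]
  rw [((h _ _ hf).2 ψ).2, ((h' _ _ hf).2 ψ).2]

omit [Fact (1 ≤ q)] in
-- The weight `‖x‖` is at most `R` on the ball, which `R⁻¹` compensates; hence a constant
-- independent of `R`.
lemma eLpNorm_norm_smul_ball_le {R : ℝ} (hR : 0 < R)
    (u : Plane → Vel) :
    ENNReal.ofReal R⁻¹ * eLpNorm (fun x => ‖x‖ • u x) q (volume.restrict (ball 0 R)) ≤
      eLpNorm u q volume := by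
  have h1 : eLpNorm (fun x => ‖x‖ • u x) q (volume.restrict (ball 0 R)) ≤
      ENNReal.ofReal R * eLpNorm u q (volume.restrict (ball 0 R)) := by
    refine eLpNorm_le_mul_eLpNorm_of_ae_le_mul ?_ q
    filter_upwards [ae_restrict_mem measurableSet_ball] with x hx
    rw [norm_smul, norm_norm]
    exact mul_le_mul_of_nonneg_right (mem_ball_zero_iff.1 hx).le (norm_nonneg _)
  calc _ ≤ ENNReal.ofReal R⁻¹ * (ENNReal.ofReal R * eLpNorm u q (volume.restrict (ball 0 R))) := by
        gcongr
    _ = eLpNorm u q (volume.restrict (ball 0 R)) := by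
        rw [← mul_assoc, ← ENNReal.ofReal_mul (by positivity), inv_mul_cancel₀ hR.ne',
          ENNReal.ofReal_one, one_mul]
    _ ≤ _ := eLpNorm_mono_measure _ Measure.restrict_le_self

lemma continuous_normSMulDistrib_apply
    (A : Lqm q m →L[ℂ] Lp Vel q (volume : Measure Plane)) (ψ : 𝓢(Plane, ℂ)) :
    Continuous fun φ => normSMulDistrib q (A φ) ψ :=
  (PointwiseConvergenceCLM.evalCLM (RingHom.id ℂ) Vel ψ).continuous.comp
    ((normSMulDistrib q).continuous.comp A.continuous)

/-- Makes the weak identities closed conditions on `φ`, so that they need checking only on the dense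
subspace. -/
lemma continuous_integral_smul_extension {F : Type*} [NormedAddCommGroup F] [NormedSpace ℂ F]
    [CompleteSpace F] (B : Lqm q m →L[ℂ] Lp F q (volume : Measure Plane)) (ψ : 𝓢(Plane, ℂ)) :
    Continuous fun φ => ∫ x, ψ x • B φ x := by
  refine ((PointwiseConvergenceCLM.evalCLM (RingHom.id ℂ) F ψ).continuous.comp
    ((Lp.toTemperedDistributionCLM F volume q).continuous.comp B.continuous)).congr fun φ => ?_
  exact Lp.toTemperedDistribution_apply _ _

lemma integral_ofRealSchwartz_smul_apply {ψ : Plane → ℝ} (hψ : ContDiff ℝ ∞ ψ)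
    (hc : HasCompactSupport ψ) (u : Lp (Plane →L[ℝ] Vel) q (volume : Measure Plane)) (e : Plane) :
    (∫ x, ofRealSchwartz ψ hψ hc x • u x) e = ∫ x, ψ x • u x e := by
  rw [ContinuousLinearMap.integral_apply (integrable_schwartz_smul _ u)]
  exact integral_congr_ae (.of_forall fun x => ofRealSchwartz_smul _ _ _ _ _)

lemma integral_fderiv_smul_velocityFun (f : symSmooth m) {ψ : Plane → ℝ} (hψ : ContDiff ℝ ∞ ψ)
    (hc : HasCompactSupport ψ) (e : Plane) :
    ∫ x, fderiv ℝ ψ x e • velocityFun f x = - ∫ x, ψ x • fderiv ℝ (velocityFun f) x e := by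
  have hv := symSmooth.contDiff_velocityFun f
  have hv' : Continuous fun x => fderiv ℝ (velocityFun f) x e :=
    (hv.continuous_fderiv (by simp)).clm_apply continuous_const
  rw [integral_smul_fderiv_eq_neg_fderiv_smul_of_integrable, neg_neg]
  · exact ((contDiff_fderiv_apply_const hψ e).continuous.smul
      hv.continuous).integrable_of_hasCompactSupport
      (hasCompactSupport_fderiv_apply_const hc e).smul_right
  · exact (hψ.continuous.smul hv').integrable_of_hasCompactSupport hc.smul_right
  · exact (hψ.continuous.smul hv.continuous).integrable_of_hasCompactSupport hc.smul_right
  · exact fun x _ => hψ.differentiable (by simp) x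
  · exact fun x _ => hv.differentiable (by simp) x

lemma divTrace_fderiv_velocityFun (f : symSmooth m) (x : Plane) :
    divTrace (fderiv ℝ (velocityFun f) x) = 0 := by
  rw [divTrace_apply]
  exact div_velocityFun f.2.1 f.2.2.1 x

lemma divTrace_integral_smul {u : Lp (Plane →L[ℝ] Vel) q (volume : Measure Plane)}
    (hu : ∀ᵐ x, divTrace (u x) = 0) {ψ : Plane → ℝ} (hψ : ContDiff ℝ ∞ ψ)
    (hc : HasCompactSupport ψ) : divTrace (∫ x, ofRealSchwartz ψ hψ hc x • u x) = 0 := by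
  rw [← divTrace.integral_comp_comm (integrable_schwartz_smul _ _)]
  refine integral_eq_zero_of_ae ?_
  filter_upwards [hu] with x hx
  rw [ofRealSchwartz_smul, map_smul, hx, smul_zero, Pi.zero_apply]

lemma divTrace_integral_smul_extension (hd : DenseRange (symSmooth.toLqm (m := m) q))
    {B : Lqm q m →L[ℂ] Lp (Plane →L[ℝ] Vel) q (volume : Measure Plane)}
    (hB : ∀ f : symSmooth m, B (symSmooth.toLqm q f) =ᵐ[volume] symSmooth.fderivVelocity f)
    (φ : Lqm q m) {ψ : Plane → ℝ} (hψ : ContDiff ℝ ∞ ψ) (hc : HasCompactSupport ψ) :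
    divTrace (∫ x, ofRealSchwartz ψ hψ hc x • B φ x) = 0 := by
  refine hd.induction_on φ (isClosed_eq (divTrace.continuous.comp
    (continuous_integral_smul_extension B _)) continuous_const) fun f => ?_
  refine divTrace_integral_smul ?_ hψ hc
  filter_upwards [hB f] with x hx
  rw [hx]
  exact divTrace_fderiv_velocityFun f x

variable {A : Lqm q m →L[ℂ] Lp Vel q (volume : Measure Plane)}
  (hA : ∀ f : symSmooth m, A (symSmooth.toLqm q f) =ᵐ[volume] symSmooth.weightedVelocity f)
include hA

lemma norm_smul_extension_ae_eq (f : symSmooth m) :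
    (fun x => ‖x‖ • A (symSmooth.toLqm q f) x) =ᵐ[volume] velocityFun f := by
  filter_upwards [hA f, ae_ne_zero] with x hx h0
  rw [hx]
  exact smul_inv_smul₀ (norm_ne_zero_iff.2 h0) _

lemma normSMulDistrib_toLqm (f : symSmooth m) (ψ : 𝓢(Plane, ℂ)) :
    normSMulDistrib q (A (symSmooth.toLqm q f)) ψ = ∫ x, ψ x • velocityFun f x := by
  rw [((isGivenBy_normSMulDistrib _).2 ψ).2]
  refine integral_congr_ae ?_
  filter_upwards [norm_smul_extension_ae_eq hA f] with x hx
  rw [hx]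

/-- Both sides are continuous in `φ`; on the dense subspace this is classical integration by parts.
-/
lemma integral_fderiv_smul_extension (hd : DenseRange (symSmooth.toLqm (m := m) q))
    {B : Lqm q m →L[ℂ] Lp (Plane →L[ℝ] Vel) q (volume : Measure Plane)}
    (hB : ∀ f : symSmooth m, B (symSmooth.toLqm q f) =ᵐ[volume] symSmooth.fderivVelocity f)
    (φ : Lqm q m) {ψ : Plane → ℝ} (hψ : ContDiff ℝ ∞ ψ) (hc : HasCompactSupport ψ) (e : Plane) :
    ∫ x, fderiv ℝ ψ x e • ‖x‖ • A φ x = - ∫ x, ψ x • B φ x e := by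
  set ψ₁ := ofRealSchwartz _ (contDiff_fderiv_apply_const hψ e)
    (hasCompactSupport_fderiv_apply_const hc e)
  have h1 : ∀ φ, normSMulDistrib q (A φ) ψ₁ = ∫ x, fderiv ℝ ψ x e • ‖x‖ • A φ x := fun φ => by
    rw [((isGivenBy_normSMulDistrib _).2 _).2]
    exact integral_congr_ae (.of_forall fun x => ofRealSchwartz_smul _ _ _ _ _)
  rw [← h1, ← integral_ofRealSchwartz_smul_apply hψ hc]
  refine hd.induction_on φ (isClosed_eq (continuous_normSMulDistrib_apply A ψ₁)
    ((ContinuousLinearMap.apply ℝ Vel e).continuous.comp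
      (continuous_integral_smul_extension B _)).neg) fun f => ?_
  have h2 : ∫ x, ψ x • B (symSmooth.toLqm q f) x e =
      ∫ x, ψ x • fderiv ℝ (velocityFun f) x e := by
    refine integral_congr_ae ?_
    filter_upwards [hB f] with x hx
    rw [hx]
    rfl
  rw [integral_ofRealSchwartz_smul_apply, h2, ← integral_fderiv_smul_velocityFun f hψ hc,
    normSMulDistrib_toLqm hA]
  exact integral_congr_ae (.of_forall fun x => ofRealSchwartz_smul _ _ _ _ _)

/-- Through the weak derivative, the divergence tested against `ψ` is minus the trace of `∫ ψ Bφ`,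
which vanishes by density. -/
lemma isDivFree_extension (hd : DenseRange (symSmooth.toLqm (m := m) q))
    {B : Lqm q m →L[ℂ] Lp (Plane →L[ℝ] Vel) q (volume : Measure Plane)}
    (hB : ∀ f : symSmooth m, B (symSmooth.toLqm q f) =ᵐ[volume] symSmooth.fderivVelocity f)
    (φ : Lqm q m) : IsDivFree fun x => ‖x‖ • A φ x := by
  intro ψ hψ hc
  have hint : ∀ e, Integrable fun x => fderiv ℝ ψ x e • ‖x‖ • A φ x := fun e => by
    have := ((isGivenBy_normSMulDistrib (A φ)).2 (ofRealSchwartz _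
      (contDiff_fderiv_apply_const hψ e) (hasCompactSupport_fderiv_apply_const hc e))).1
    exact this.congr (.of_forall fun x => ofRealSchwartz_smul _ _ _ _ _)
  have hi : ∀ i : Fin 2, ∫ x, fderiv ℝ ψ x (EuclideanSpace.single i 1) • (‖x‖ • A φ x) i =
      -(∫ x, ofRealSchwartz ψ hψ hc x • B φ x) (EuclideanSpace.single i 1) i := fun i => by
    have h1 := ((EuclideanSpace.proj i : Vel →L[ℂ] ℂ).restrictScalars ℝ).integral_comp_comm
      (hint (EuclideanSpace.single i 1))
    rw [integral_fderiv_smul_extension hA hd hB φ hψ hc,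
      ← integral_ofRealSchwartz_smul_apply hψ hc] at h1
    simpa using h1
  rw [integral_finsetSum, Finset.sum_congr rfl fun i _ => hi i, Finset.sum_neg_distrib,
    ← divTrace_apply, divTrace_integral_smul_extension hd hB φ hψ hc, neg_zero]
  intro i _
  simpa using ((EuclideanSpace.proj i : Vel →L[ℂ] ℂ).restrictScalars ℝ).integrable_comp
    (hint (EuclideanSpace.single i 1))

/-- Along the approximants of `exists_uniform_approx`, the distributions converge by continuity of
`A` and the integrals by dominated convergence. -/
lemma isGivenBy_velocity (φ : Lqm q m) (f : 𝓢(Plane, ℂ))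
    (hφ : (φ : Lp ℂ q (volume : Measure Plane)) =ᵐ[volume] f) :
    IsGivenBy (normSMulDistrib q (A φ)) (velocity f) := by
  obtain ⟨fn, K, hlim, hK, hn⟩ := exists_uniform_approx φ f hφ
  rw [velocity_eq]
  have hz : Filter.Tendsto (fun n : ℕ => (n + 1 : ℝ)⁻¹ * K) Filter.atTop (nhds 0) := by
    simpa using (tendsto_one_div_add_atTop_nhds_zero_nat (𝕜 := ℝ)).mul_const K
  have hu : TendstoUniformly (fun n => velocityFun (fn n)) (velocityFun f) Filter.atTop := by
    rw [Metric.tendstoUniformly_iff]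
    intro ε hε
    filter_upwards [hz.eventually (gt_mem_nhds hε)] with n h x
    rw [dist_eq_norm]
    exact (hn n x).trans_lt h
  have hc : Continuous (velocityFun f) := hu.continuous (.of_forall fun n =>
    (symSmooth.contDiff_velocityFun (fn n)).continuous)
  have hK0 : 0 ≤ K := (norm_nonneg _).trans (hK 0)
  refine ⟨hc.locallyIntegrable, fun ψ => ⟨?_, ?_⟩⟩
  · refine (ψ.integrable.norm.mul_const K).mono'
      (ψ.continuous.smul hc).aestronglyMeasurable (.of_forall fun x => ?_)
    rw [norm_smul]
    exact mul_le_mul_of_nonneg_left (hK x) (norm_nonneg _)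
  · refine tendsto_nhds_unique
      (((continuous_normSMulDistrib_apply A ψ).tendsto φ).comp hlim) ?_
    simp only [Function.comp_def, normSMulDistrib_toLqm hA]
    -- The limit velocity and the error are each at most `K`, whence `2 * K`.
    refine tendsto_integral_of_dominated_convergence (fun x => ‖ψ x‖ * (2 * K)) (fun n =>
      (ψ.continuous.smul (symSmooth.contDiff_velocityFun (fn n)).continuous).aestronglyMeasurable)
      (ψ.integrable.norm.mul_const _) (fun n => .of_forall fun x => ?_)
      (.of_forall fun x => (hu.tendsto_at x).const_smul _)
    rw [norm_smul]
    refine mul_le_mul_of_nonneg_left ?_ (norm_nonneg _)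
    have h1 : (n + 1 : ℝ)⁻¹ * K ≤ K :=
      mul_le_of_le_one_left hK0 (inv_le_one_of_one_le₀ (by linarith [n.cast_nonneg (α := ℝ)]))
    have h2 := norm_sub_norm_le (velocityFun (fn n) x) (velocityFun f x)
    rw [norm_sub_rev] at h2
    linarith [hn n x, hK x]

lemma hasW1qLocDeriv_extension (hd : DenseRange (symSmooth.toLqm (m := m) q))
    {B : Lqm q m →L[ℂ] Lp (Plane →L[ℝ] Vel) q (volume : Measure Plane)}
    (hB : ∀ f : symSmooth m, B (symSmooth.toLqm q f) =ᵐ[volume] symSmooth.fderivVelocity f)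
    (φ : Lqm q m) : HasW1qLocDeriv q (fun x => ‖x‖ • A φ x) (B φ) where
  memLqLoc K hK := by
    obtain ⟨R, hR⟩ := hK.isBounded.subset_ball_lt 0 0
    refine (MemLp.mono_measure (μ := volume.restrict (ball 0 R))
      (Measure.restrict_mono hR.2 le_rfl) ⟨?_, ?_⟩)
    · exact (continuous_norm.aestronglyMeasurable.smul (Lp.aestronglyMeasurable _)).restrict
    · have h := (eLpNorm_norm_smul_ball_le (q := q) hR.1 (A φ)).trans_lt (Lp.memLp (A φ)).2
      exact ENNReal.lt_top_of_mul_ne_top_right h.ne (by simpa using hR.1)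
  memLqLoc_deriv K _ := (Lp.memLp (B φ)).restrict K
  integral_eq ψ hψ hc e := integral_fderiv_smul_extension hA hd hB φ hψ hc e

end Properties

end BiotSavart

end

/-! ### Assembly of the theorem. -/

theorem mainTheorem4 (m : ℕ) (hm : 2 ≤ m) (q : ℝ≥0∞) [Fact (1 ≤ q)] (hq : 2 ≤ q) (hq' : q < ⊤) :
    ∃ T : Lqm q m →L[ℂ] 𝓢'(Plane, Vel),
      ExtendsConv T ∧
      (∃ C : ℝ, 0 < C ∧ ∀ φ : Lqm q m, ∃ (v : Plane → Vel) (Dv : Plane → Plane →L[ℝ] Vel),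
        HasW1qLocDeriv q v Dv ∧
        (∀ R : ℝ, 0 < R →
          ENNReal.ofReal R⁻¹ * eLpNorm v q (volume.restrict (Metric.ball 0 R)) +
              eLpNorm Dv q (volume.restrict (Metric.ball 0 R)) ≤
            ENNReal.ofReal C * eLpNorm (φ : Lp ℂ q (volume : Measure Plane)) q volume) ∧
        IsDivFree v ∧
        IsGivenBy (T φ) v) ∧
      ∀ T' : Lqm q m → 𝓢'(Plane, Vel), Continuous T' → ExtendsConv T' → T' = T := by
  have hd : DenseRange (symSmooth.toLqm (m := m) q) := denseRange_toLqm (by omega) hq'.ne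
  obtain ⟨C₁, A, hC₁, hA⟩ := exists_extension_weightedVelocity hm hq hq'
  obtain ⟨C₂, B, hC₂, hB⟩ := exists_extension_fderivVelocity hm hq hq'
  have hT : ExtendsConv (normSMulDistrib q ∘L A) := fun φ f hφ => isGivenBy_velocity hA φ f hφ
  -- The summand `1` only makes the constant strictly positive.
  refine ⟨normSMulDistrib q ∘L A, hT, ⟨C₁ + C₂ + 1, by positivity, fun φ => ?_⟩, fun T' hc h' =>
    eq_of_extendsConv hd (ContinuousLinearMap.continuous _) hc hT h'⟩
  refine ⟨fun x => ‖x‖ • A φ x, B φ, hasW1qLocDeriv_extension hA hd hB φ, fun R hR => ?_,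
    isDivFree_extension hA hd hB φ, isGivenBy_normSMulDistrib (A φ)⟩
  have hle : ∀ {F : Type} [NormedAddCommGroup F] (u : Lp F q (volume : Measure Plane)) (C : NNReal),
      ‖u‖ ≤ C * ‖φ‖ → eLpNorm u q volume ≤
        C * eLpNorm (φ : Lp ℂ q (volume : Measure Plane)) q volume := fun {F} _ u C h => by
    rw [← Lp.enorm_def, ← Lp.enorm_def, ← ofReal_norm, ← ofReal_norm, ← ENNReal.ofReal_coe_nnreal,
      ← ENNReal.ofReal_mul C.coe_nonneg]
    exact ENNReal.ofReal_le_ofReal h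
  calc _ ≤ eLpNorm (A φ) q volume + eLpNorm (B φ) q volume :=
        add_le_add (eLpNorm_norm_smul_ball_le hR (A φ))
          (eLpNorm_mono_measure _ Measure.restrict_le_self)
    _ ≤ (C₁ + C₂) * eLpNorm (φ : Lp ℂ q (volume : Measure Plane)) q volume := by
        rw [add_mul]
        exact add_le_add (hle _ _ (hC₁ φ)) (hle _ _ (hC₂ φ))
    _ ≤ _ := by
        gcongr
        rw [← ENNReal.coe_add, ← ENNReal.ofReal_coe_nnreal]
        exact ENNReal.ofReal_le_ofReal (by push_cast; linarith)
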